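/- Call $\psi:\mathbb R\to\mathbb C$ an orthogonal wavelet if the functions $\psi_{j,k}(x)=2^{j/2}\psi(2^jx-k)$, $j,k\in\mathbb Z$, form an orthonormal basis of $L^2(\mathbb R)$. Call a continuous integrable function $\psi$ band-limited if its Fourier transform $\widehat\psi(\xi)=\int_{\mathbb R}\psi(x)e^{-2\pi i x\xi}\,dx$ has compact support, and of Meyer type if $\widehat\psi\in C^\infty(\mathbb R)$ and $\operatorname{supp}\widehat\psi\subset\{\xi: \tfrac13\le|\xi|\le\tfrac43\}$. Write $\ln^{(i)}$ and $\exp^{(i)}$ for the $i$-fold iterates of $\ln$ and $\exp$. There is an absolute constant $c'>0$ such that the following holds. 1. For every $0<\varepsilon\le 1$ there are a constant $c>0$, depending only on $\varepsilon$, and a band-limited orthogonal wavelet $\psi$ of Meyer type such that $$|\psi(x)|\le c\exp\Big\{-\frac{c'\varepsilon|x|}{[\ln(e+|x|)]^{1+\varepsilon}}\Big\},\qquad x\in\mathbb R.$$ 2. For every integer $\ell\ge1$ and every $0<\varepsilon\le1$ there are a constant $c>0$, depending only on $\varepsilon$ and $\ell$, and a band-limited orthogonal wavelet $\psi$ of Meyer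 type such that $$|\psi(x)|\le c\exp\Big\{-\frac{c'\varepsilon|x|}{\Big(\prod_{i=1}^{\ell}\ln^{(i)}\big(\exp^{(i)}1+|x|\big)\Big)\big[\ln^{(\ell+1)}\big(\exp^{(\ell+1)}1+|x|\big)\big]^{1+\varepsilon}}\Big\},\qquad x\in\mathbb R.$$ -/

import Mathlib

open MeasureTheory
open scoped FourierTransform ContDiff

noncomputable section

/-- The dyadic dilations and integer translations `ψ_{j,k}(x) = 2^{j/2} ψ(2^j x - k)`. -/
def dyadicWavelet (ψ : ℝ → ℂ) (j k : ℤ) (x : ℝ) : ℂ :=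
  (((2 : ℝ) ^ ((j : ℝ) / 2) : ℝ) : ℂ) * ψ ((2 : ℝ) ^ j * x - (k : ℝ))

/-- `ψ` is an orthogonal wavelet: the (classes of the) functions `ψ_{j,k}`, `j, k ∈ ℤ`,
form an orthonormal basis of the complex Hilbert space `L²(ℝ)`. -/
def IsOrthogonalWavelet (ψ : ℝ → ℂ) : Prop :=
  ∃ b : HilbertBasis (ℤ × ℤ) ℂ (Lp ℂ 2 (volume : Measure ℝ)),
    ∀ j k : ℤ, (b (j, k) : ℝ → ℂ) =ᵐ[volume] dyadicWavelet ψ j k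

/-- `ψ` is band-limited: a continuous integrable function whose Fourier transform
has compact support. -/
structure IsBandLimited (ψ : ℝ → ℂ) : Prop where
  continuous : Continuous ψ
  integrable : Integrable ψ
  hasCompactSupport_fourier : HasCompactSupport (𝓕 ψ : ℝ → ℂ)

/-- `ψ` is of Meyer type: its Fourier transform is smooth and is supported in Meyer's band,
which is `2π/3 ≤ |ξ| ≤ 8π/3` for the kernel `exp (-i x ξ)`, that is, `1/3 ≤ |ξ| ≤ 4/3` for the
kernel `exp (-2π i x ξ)` that is used by `𝓕`. -/
structure IsMeyerType (ψ : ℝ → ℂ) : Prop where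
  contDiff_fourier : ContDiff ℝ ∞ (𝓕 ψ : ℝ → ℂ)
  tsupport_fourier : tsupport (𝓕 ψ : ℝ → ℂ) ⊆ {ξ : ℝ | 1 / 3 ≤ |ξ| ∧ |ξ| ≤ 4 / 3}

/-- `ln ⋯ ln (exp ⋯ exp 1 + t)` with `i` logarithms and `i` exponentials. -/
def iterLog (i : ℕ) (t : ℝ) : ℝ :=
  Real.log^[i] (Real.exp^[i] 1 + t)

/-- The product `ln (e + t) ⋯ ln^{(ℓ)} (exp^{(ℓ)} 1 + t) · [ln^{(ℓ+1)} (exp^{(ℓ+1)} 1 + t)]^{1+ε}`,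
where the upper index in parentheses counts iterations. -/
def iterLogProduct (ℓ : ℕ) (ε t : ℝ) : ℝ :=
  (∏ i ∈ Finset.Icc 1 ℓ, iterLog i t) * iterLog (ℓ + 1) t ^ (1 + ε)

end

/-! The construction works for every decreasing rate `m` with values in (0, 1] and ∑ m(n)/n < ∞:
there is a Meyer wavelet bounded by a constant times exp(-|x| m(|x|)). The rates ε / (ln ⋯
[ln^{(ℓ+1)}]^{1+ε}) qualify by the integral test, so c' = 1 works.

Decay. Let N(t) be the largest j with j ≤ t m(j). A sum ∑ a_j U_j of independent uniform variables
with a_j comparable to m(j)/j lies in a bounded interval, and each factor of its characteristic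
function with j ≤ N(|x|) is at most 1/e. Hence the characteristic function is O(exp(-N(|x|))), and
N(t) ≥ t m(t) - 1. Convolution with a smooth bump gives a smooth compactly supported density `g`
whose transform is bounded by the weight w(x) = exp(-N(|x|)) / (1 + x²) (`exists_symmetric_bump`).

Passage to the wavelet. Up to additive constants N is subadditive, so the functions O(w) form a
convolution algebra (`norm_convolution_le`). A primitive G of `g` gives the angle Φ(ξ) = G(|ξ|) -
G(|ξ|/2), and the power series of the sine converges in the algebra, so sin(πΦ/2) still has
transform O(w) (`exists_fourierInv_sin_decay`). No analyticity is needed beyond that of the sine.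

Orthonormality. Let β = exp(-πiξ) sin(πΦ/2). For F smooth with compact support away from 0, Poisson
summation turns ∑_k |⟨F, ψ̂_{j,k}⟩|² into autocorrelations at integer shifts n, and the support of β
leaves only |n| ≤ 2. The shifts n = 0 sum over j to ‖F‖², because ∑_j |β(2^j ξ)|² = 1. The shift ±1
at scale j + 1 cancels the shift ±2 at scale j; the factor exp(-πiξ) supplies the opposite signs
(`hasSum_sum_correlation`). Parseval's identity on this total set, which contains the unit vectors
ψ̂_{j,k} themselves, makes them an orthonormal basis, and Plancherel carries it back. -/

open scoped SchwartzMap ComplexConjugate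

/-! ### Submultiplicative weights of subexponential decay -/

open Classical in
/-- The largest `j` with `j ≤ t * m j`. -/
noncomputable def countBelow (m : ℝ → ℝ) (t : ℝ) : ℕ :=
  Nat.findGreatest (fun j : ℕ => (j : ℝ) ≤ t * m j) ⌈t⌉₊

/-- The weight `exp (-N |x|) / (1 + x²)`, where `N` is the counting function of `m`. -/
noncomputable def decayWeight (m : ℝ → ℝ) (x : ℝ) : ℝ :=
  Real.exp (-(countBelow m |x| : ℝ)) / (1 + x ^ 2)

lemma decayWeight_neg (m : ℝ → ℝ) (x : ℝ) : decayWeight m (-x) = decayWeight m x := by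
  simp [decayWeight]

/-- A decreasing function on `[0, ∞)` with values in `(0, 1]`. -/
structure IsDecayRate (m : ℝ → ℝ) : Prop where
  anti : ∀ s t, 0 ≤ s → s ≤ t → m t ≤ m s
  pos : ∀ t, 0 ≤ t → 0 < m t
  le_one : ∀ t, 0 ≤ t → m t ≤ 1

namespace IsDecayRate

variable {m : ℝ → ℝ} (hm : IsDecayRate m)
include hm

lemma countBelow_le {t : ℝ} (ht : 0 ≤ t) : (countBelow m t : ℝ) ≤ t * m (countBelow m t) := by
  classical
  refine Nat.findGreatest_spec (P := fun j : ℕ => (j : ℝ) ≤ t * m j) (Nat.zero_le _) ?_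
  simpa using mul_nonneg ht (hm.pos 0 le_rfl).le

/-- The search bound ⌈t⌉ in `countBelow` loses nothing: since m ≤ 1, every admissible j is at most
t. -/
lemma le_countBelow {t : ℝ} (ht : 0 ≤ t) {j : ℕ} (hj : (j : ℝ) ≤ t * m j) :
    j ≤ countBelow m t := by
  classical
  refine Nat.le_findGreatest ?_ hj
  have h1 : (j : ℝ) ≤ t := hj.trans (mul_le_of_le_one_right ht (hm.le_one _ (by positivity)))
  exact_mod_cast h1.trans (Nat.le_ceil t)

lemma le_of_le_countBelow {t : ℝ} (ht : 0 ≤ t) {j : ℕ} (hj : j ≤ countBelow m t) :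
    (j : ℝ) ≤ t * m j := by
  have h1 : (j : ℝ) ≤ countBelow m t := by exact_mod_cast hj
  calc (j : ℝ) ≤ countBelow m t := h1
    _ ≤ t * m (countBelow m t) := hm.countBelow_le ht
    _ ≤ t * m j := by gcongr; exact hm.anti _ _ (by positivity) h1

lemma countBelow_mono {s t : ℝ} (hs : 0 ≤ s) (hst : s ≤ t) : countBelow m s ≤ countBelow m t := by
  refine hm.le_countBelow (hs.trans hst) ((hm.countBelow_le hs).trans ?_)
  have := (hm.pos (countBelow m s) (by positivity)).le
  gcongr

/-- If n = N(s + t) exceeded the bound, maximality of N(s) and N(t) together with the monotonicity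
of `m` would give s m(n) < N(s) + 1 and t m(n) < N(t) + 1. Adding these contradicts n ≤ (s + t)
m(n). -/
lemma countBelow_add_le {s t : ℝ} (hs : 0 ≤ s) (ht : 0 ≤ t) :
    countBelow m (s + t) ≤ countBelow m s + countBelow m t + 1 := by
  by_contra! h
  set n := countBelow m (s + t)
  have key : ∀ r : ℝ, 0 ≤ r → countBelow m r + 1 ≤ n → r * m n < countBelow m r + 1 := by
    intro r hr hrn
    have h1 : ¬ (((countBelow m r + 1 : ℕ) : ℝ) ≤ r * m (countBelow m r + 1 : ℕ)) := by
      intro h2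
      have := hm.le_countBelow hr h2
      omega
    push Not at h1
    have h3 : r * m n ≤ r * m (countBelow m r + 1 : ℕ) := by
      gcongr
      exact hm.anti _ _ (by positivity) (by exact_mod_cast hrn)
    push_cast at h1 h3
    linarith
  have h1 := key s hs (by omega)
  have h2 := key t ht (by omega)
  have h3 : (n : ℝ) ≤ (s + t) * m n := hm.countBelow_le (by positivity)
  have h4 : ((countBelow m s + countBelow m t + 1 + 1 : ℕ) : ℝ) ≤ n := by exact_mod_cast h
  push_cast at h4
  linarith [add_mul s t (m n)]

/-- The integer j = ⌊t m(t)⌋ is admissible: j ≤ t because m ≤ 1, hence m(t) ≤ m(j) and j ≤ t m(j).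
-/
lemma sub_one_le_countBelow {t : ℝ} (ht : 0 ≤ t) : t * m t - 1 ≤ countBelow m t := by
  have h0 : 0 ≤ t * m t := mul_nonneg ht (hm.pos t ht).le
  have h1 := Nat.floor_le h0
  have h2 := Nat.lt_floor_add_one (t * m t)
  have h3 : t * m t ≤ t := mul_le_of_le_one_right ht (hm.le_one t ht)
  have : ⌊t * m t⌋₊ ≤ countBelow m t := by
    refine hm.le_countBelow ht (h1.trans ?_)
    gcongr
    exact hm.anti _ _ (by positivity) (h1.trans h3)
  have : (⌊t * m t⌋₊ : ℝ) ≤ countBelow m t := by exact_mod_cast this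
  linarith

lemma countBelow_abs_add_le (x y : ℝ) :
    (countBelow m |x + y| : ℝ) ≤ countBelow m |x| + countBelow m |y| + 1 := by
  have h1 := hm.countBelow_mono (abs_nonneg _) (abs_add_le x y)
  have h2 := hm.countBelow_add_le (abs_nonneg x) (abs_nonneg y)
  exact_mod_cast h1.trans h2

omit hm in
lemma decayWeight_pos (x : ℝ) : 0 < decayWeight m x := by
  unfold decayWeight; positivity

/-- The weight is submultiplicative, with a gain that is integrable in either argument. -/
lemma decayWeight_mul_le (x y : ℝ) :
    decayWeight m x * decayWeight m y ≤
      2 * Real.exp 1 * decayWeight m (x + y) * ((1 + x ^ 2)⁻¹ + (1 + y ^ 2)⁻¹) := by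
  unfold decayWeight
  have h1 : Real.exp (-(countBelow m |x| : ℝ)) * Real.exp (-(countBelow m |y| : ℝ)) ≤
      Real.exp 1 * Real.exp (-(countBelow m |x + y| : ℝ)) := by
    rw [← Real.exp_add, ← Real.exp_add, Real.exp_le_exp]
    linarith [hm.countBelow_abs_add_le x y]
  have h2 : (1 + x ^ 2)⁻¹ * (1 + y ^ 2)⁻¹ ≤
      2 * (1 + (x + y) ^ 2)⁻¹ * ((1 + x ^ 2)⁻¹ + (1 + y ^ 2)⁻¹) := by
    have e : (1 + x ^ 2)⁻¹ + (1 + y ^ 2)⁻¹ =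
        (1 + x ^ 2)⁻¹ * (1 + y ^ 2)⁻¹ * (2 + x ^ 2 + y ^ 2) := by field_simp; ring
    rw [e]
    -- This amounts to 1 + (x + y)² ≤ 2 (2 + x² + y²).
    have h3 : 1 ≤ 2 * (1 + (x + y) ^ 2)⁻¹ * (2 + x ^ 2 + y ^ 2) := by
      rw [mul_comm 2, mul_assoc, ← div_eq_inv_mul, one_le_div (by positivity)]
      nlinarith [sq_nonneg (x - y)]
    have h4 : 0 ≤ (1 + x ^ 2)⁻¹ * (1 + y ^ 2)⁻¹ := by positivity
    nlinarith
  calc _ = (Real.exp (-(countBelow m |x| : ℝ)) * Real.exp (-(countBelow m |y| : ℝ))) *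
        ((1 + x ^ 2)⁻¹ * (1 + y ^ 2)⁻¹) := by ring
    _ ≤ (Real.exp 1 * Real.exp (-(countBelow m |x + y| : ℝ))) *
        (2 * (1 + (x + y) ^ 2)⁻¹ * ((1 + x ^ 2)⁻¹ + (1 + y ^ 2)⁻¹)) := by gcongr
    _ = _ := by ring

/-- Functions dominated by the weight are stable under convolution. -/
lemma norm_convolution_le {u v : ℝ → ℂ} {A B : ℝ} (hA : ∀ x, ‖u x‖ ≤ A * decayWeight m x)
    (hB : ∀ x, ‖v x‖ ≤ B * decayWeight m x) (x : ℝ) :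
    ‖∫ t, u t * v (x - t)‖ ≤ A * B * (4 * Real.exp 1 * Real.pi) * decayWeight m x := by
  have hA0 : 0 ≤ A := nonneg_of_mul_nonneg_left ((norm_nonneg _).trans (hA 0)) (decayWeight_pos 0)
  have hB0 : 0 ≤ B := nonneg_of_mul_nonneg_left ((norm_nonneg _).trans (hB 0)) (decayWeight_pos 0)
  have hi := integrable_inv_one_add_sq
  have hi' : Integrable fun t : ℝ => (1 + (x - t) ^ 2)⁻¹ := hi.comp_sub_left x
  have hb : ∀ t, ‖u t * v (x - t)‖ ≤ A * B * (2 * Real.exp 1 * decayWeight m x) *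
      ((1 + t ^ 2)⁻¹ + (1 + (x - t) ^ 2)⁻¹) := by
    intro t
    have h1 := hm.decayWeight_mul_le t (x - t)
    rw [add_sub_cancel] at h1
    calc ‖u t * v (x - t)‖ ≤ (A * decayWeight m t) * (B * decayWeight m (x - t)) := by
          rw [norm_mul]
          exact mul_le_mul (hA t) (hB _) (norm_nonneg _)
            (mul_nonneg hA0 (decayWeight_pos t).le)
      _ = A * B * (decayWeight m t * decayWeight m (x - t)) := by ring
      _ ≤ A * B * (2 * Real.exp 1 * decayWeight m x *
          ((1 + t ^ 2)⁻¹ + (1 + (x - t) ^ 2)⁻¹)) := by gcongr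
      _ = _ := by ring
  refine (norm_integral_le_of_norm_le ((hi.add hi').const_mul _) (ae_of_all _ hb)).trans ?_
  rw [integral_const_mul]
  simp only [Pi.add_apply]
  rw [integral_add hi hi', integral_sub_left_eq_self (fun t : ℝ => (1 + t ^ 2)⁻¹) volume x,
    integral_univ_inv_one_add_sq]
  apply le_of_eq; ring

/-- The weight is stable under translation; this absorbs the shift by 1/2 that the phase exp(-πiξ)
produces. -/
lemma decayWeight_sub_le (x a : ℝ) :
    decayWeight m (x - a) ≤
      2 * Real.exp (countBelow m |a| + 1) * (1 + a ^ 2) * decayWeight m x := by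
  unfold decayWeight
  have h1 : Real.exp (-(countBelow m |x - a| : ℝ)) ≤
      Real.exp (countBelow m |a| + 1) * Real.exp (-(countBelow m |x| : ℝ)) := by
    rw [← Real.exp_add, Real.exp_le_exp]
    have := hm.countBelow_abs_add_le (x - a) a
    rw [sub_add_cancel] at this
    linarith
  have h2 : (1 + (x - a) ^ 2)⁻¹ ≤ 2 * (1 + a ^ 2) * (1 + x ^ 2)⁻¹ := by
    rw [← div_eq_mul_inv, inv_eq_one_div, div_le_div_iff₀ (by positivity) (by positivity)]
    nlinarith [sq_nonneg (x - 2 * a), sq_nonneg (a * (x - a))]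
  calc _ = Real.exp (-(countBelow m |x - a| : ℝ)) * (1 + (x - a) ^ 2)⁻¹ := by ring
    _ ≤ (Real.exp (countBelow m |a| + 1) * Real.exp (-(countBelow m |x| : ℝ))) *
        (2 * (1 + a ^ 2) * (1 + x ^ 2)⁻¹) := by gcongr
    _ = _ := by ring

lemma decayWeight_two_mul_le (x : ℝ) : decayWeight m (2 * x) ≤ decayWeight m x := by
  unfold decayWeight
  have : (countBelow m |x| : ℝ) ≤ countBelow m |2 * x| := by
    exact_mod_cast hm.countBelow_mono (abs_nonneg x)
      (by rw [abs_mul, abs_two]; linarith [abs_nonneg x])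
  refine div_le_div₀ (Real.exp_nonneg _) ?_ (by positivity) (by nlinarith [sq_nonneg x])
  gcongr

lemma decayWeight_le_exp (x : ℝ) : decayWeight m x ≤ Real.exp 1 * Real.exp (-(|x| * m |x|)) := by
  unfold decayWeight
  have := hm.sub_one_le_countBelow (abs_nonneg x)
  calc _ ≤ Real.exp (-(countBelow m |x| : ℝ)) :=
        div_le_self (Real.exp_nonneg _) (by nlinarith [sq_nonneg x])
    _ ≤ _ := by rw [← Real.exp_add, Real.exp_le_exp]; linarith

end IsDecayRate

/-! ### Iterated logarithms -/

section IteratedLog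

lemma iterate_log_iterate_exp_one (n : ℕ) : Real.log^[n] (Real.exp^[n] 1) = 1 :=
  Function.LeftInverse.iterate Real.log_exp n 1

lemma iterate_exp_one_pos (n : ℕ) : 0 < Real.exp^[n] 1 := by
  cases n with
  | zero => simp
  | succ n => rw [Function.iterate_succ_apply']; exact Real.exp_pos _

lemma iterate_exp_one_le_log {n : ℕ} {y : ℝ} (hy : Real.exp^[n + 1] 1 ≤ y) :
    Real.exp^[n] 1 ≤ Real.log y := by
  rw [Function.iterate_succ_apply'] at hy
  exact (Real.le_log_iff_exp_le ((Real.exp_pos _).trans_le hy)).2 hy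

lemma iterate_exp_one_mono : Monotone fun n : ℕ => Real.exp^[n] (1 : ℝ) := by
  refine monotone_nat_of_le_succ fun n => ?_
  simp only [Function.iterate_succ_apply']
  linarith [Real.add_one_le_exp (Real.exp^[n] 1)]

lemma iterate_log_le_iterate_log (n : ℕ) : ∀ {x y : ℝ}, Real.exp^[n] 1 ≤ x → x ≤ y →
    Real.log^[n] x ≤ Real.log^[n] y := by
  induction n with
  | zero => intro x y _ h; simpa using h
  | succ n ih =>
    intro x y hx hxy
    simp only [Function.iterate_succ_apply]
    exact ih (iterate_exp_one_le_log hx)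
      (Real.log_le_log ((iterate_exp_one_pos _).trans_le hx) hxy)

lemma one_le_iterate_log {n : ℕ} {y : ℝ} (hy : Real.exp^[n] 1 ≤ y) : 1 ≤ Real.log^[n] y := by
  simpa [iterate_log_iterate_exp_one] using iterate_log_le_iterate_log n le_rfl hy

lemma hasDerivAt_iterate_log (n : ℕ) {y : ℝ} (hy : Real.exp^[n] 1 ≤ y) :
    HasDerivAt (Real.log^[n]) (∏ i ∈ Finset.range n, Real.log^[i] y)⁻¹ y := by
  induction n with
  | zero => simpa using hasDerivAt_id y
  | succ n ih =>
    have h1 : Real.exp^[n] 1 ≤ y := (iterate_exp_one_mono (Nat.le_succ n)).trans hy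
    have h2 : Real.log^[n] y ≠ 0 := (zero_lt_one.trans_le (one_le_iterate_log h1)).ne'
    rw [Function.iterate_succ']
    rw [Finset.prod_range_succ, mul_inv, mul_comm]
    exact (Real.hasDerivAt_log h2).comp y (ih h1)

lemma one_le_iterLog (i : ℕ) {t : ℝ} (ht : 0 ≤ t) : 1 ≤ iterLog i t :=
  one_le_iterate_log (by linarith)

lemma iterLog_mono (i : ℕ) {s t : ℝ} (hs : 0 ≤ s) (hst : s ≤ t) : iterLog i s ≤ iterLog i t :=
  iterate_log_le_iterate_log i (by linarith) (by linarith)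

lemma one_le_iterLogProduct (ℓ : ℕ) {ε t : ℝ} (hε : 0 < ε) (ht : 0 ≤ t) :
    1 ≤ iterLogProduct ℓ ε t := by
  refine one_le_mul_of_one_le_of_one_le ?_ (Real.one_le_rpow (one_le_iterLog _ ht) (by linarith))
  simpa using Finset.prod_le_prod (s := Finset.Icc 1 ℓ) (f := fun _ => (1 : ℝ))
    (fun _ _ => zero_le_one) fun i _ => one_le_iterLog i ht

lemma iterLogProduct_mono (ℓ : ℕ) {ε s t : ℝ} (hε : 0 < ε) (hs : 0 ≤ s) (hst : s ≤ t) :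
    iterLogProduct ℓ ε s ≤ iterLogProduct ℓ ε t := by
  have h0 : ∀ i, 0 ≤ iterLog i s := fun i => zero_le_one.trans (one_le_iterLog i hs)
  refine mul_le_mul (Finset.prod_le_prod (fun i _ => h0 i) fun i _ => iterLog_mono i hs hst)
    (Real.rpow_le_rpow (h0 _) (iterLog_mono _ hs hst) (by linarith)) (Real.rpow_nonneg (h0 _) _)
    (Finset.prod_nonneg fun i _ => (h0 i).trans (iterLog_mono i hs hst))

/-- The rate `ε / (ln ⋯ ln^{(ℓ)} [ln^{(ℓ+1)}]^{1+ε})`. -/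
noncomputable def iterLogRate (ℓ : ℕ) (ε t : ℝ) : ℝ := ε / iterLogProduct ℓ ε t

lemma isDecayRate_iterLogRate (ℓ : ℕ) {ε : ℝ} (hε : 0 < ε) (hε1 : ε ≤ 1) :
    IsDecayRate (iterLogRate ℓ ε) where
  anti s t hs hst := div_le_div_of_nonneg_left hε.le
    (zero_lt_one.trans_le (one_le_iterLogProduct ℓ hε hs)) (iterLogProduct_mono ℓ hε hs hst)
  pos t ht := div_pos hε (zero_lt_one.trans_le (one_le_iterLogProduct ℓ hε ht))
  le_one t ht := by
    have h := one_le_iterLogProduct ℓ hε ht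
    exact (div_le_one (zero_lt_one.trans_le h)).2 (hε1.trans h)

/-- If `f` is bounded above and its derivative dominates a decreasing nonnegative function `u`,
then `∑ u n` converges. -/
lemma summable_of_le_deriv {f f' u : ℝ → ℝ} {a M : ℝ} (hf : ∀ t, a ≤ t → HasDerivAt f (f' t) t)
    (hM : ∀ t, a ≤ t → f t ≤ M) (hu0 : ∀ t, a ≤ t → 0 ≤ u t)
    (hu : ∀ s t, a ≤ s → s ≤ t → u t ≤ f' s) :
    Summable fun n : ℕ => u n := by
  obtain ⟨k, hk⟩ := exists_nat_ge a
  rw [← summable_nat_add_iff (k + 1)]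
  have hstep : ∀ n : ℕ, u ((n + (k + 1) : ℕ) : ℝ) ≤ f ((n + 1 : ℕ) + k) - f (n + k) := by
    intro n
    have ha : ∀ t, (n : ℝ) + k ≤ t → a ≤ t := fun t ht => by
      have : (0 : ℝ) ≤ n := by positivity
      linarith
    -- The mean value theorem on each unit interval bounds the value of `u` at the right endpoint by
    -- the increment of `f`, and these increments telescope.
    obtain ⟨c, hc, hc'⟩ := exists_hasDerivAt_eq_slope f f' (a := (n : ℝ) + k)
      (b := ((n + 1 : ℕ) : ℝ) + k) (by push_cast; linarith)
      (fun t ht => (hf t (ha t ht.1)).continuousAt.continuousWithinAt)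
      (fun t ht => hf t (ha t ht.1.le))
    have h1 : ((n + 1 : ℕ) : ℝ) + k - (n + k) = 1 := by push_cast; ring
    rw [h1, div_one] at hc'
    rw [← hc']
    refine hu c _ (ha c hc.1.le) (hc.2.le.trans (le_of_eq ?_))
    push_cast; ring
  refine summable_of_sum_range_le (c := M - f k) (fun n => hu0 _ ?_) fun n => ?_
  · push_cast
    have : (0 : ℝ) ≤ n := by positivity
    linarith
  · refine (Finset.sum_le_sum fun i _ => hstep i).trans ?_
    rw [Finset.sum_range_sub (fun n : ℕ => f (n + k))]
    have := hM (n + k) (by have : (0 : ℝ) ≤ n := by positivity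
                           linarith)
    simpa using this

lemma summable_iterLogRate_div (ℓ : ℕ) {ε : ℝ} (hε : 0 < ε) (hε1 : ε ≤ 1) :
    Summable fun n : ℕ => iterLogRate ℓ ε n / n := by
  have hrate := isDecayRate_iterLogRate ℓ hε hε1
  have hL1 : ∀ t, Real.exp^[ℓ + 1] 1 ≤ t → 1 ≤ Real.log^[ℓ + 1] t := fun t ht =>
    one_le_iterate_log ht
  -- The function -(ln^{(ℓ+1)} t)^{-ε} is bounded above by 0 and has derivative ε / (t ln t ⋯
  -- ln^{(ℓ)} t [ln^{(ℓ+1)} t]^{1+ε}). The shifted logarithms in the rate only make its terms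
  -- smaller.
  refine summable_of_le_deriv (a := Real.exp^[ℓ + 1] 1) (M := 0)
    (u := fun t => iterLogRate ℓ ε t / t)
    (f := fun t => -((Real.log^[ℓ + 1] t) ^ (-ε)))
    (f' := fun t => ε * (∏ i ∈ Finset.range (ℓ + 1), Real.log^[i] t)⁻¹ *
      (Real.log^[ℓ + 1] t) ^ (-ε - 1)) ?_ ?_ ?_ ?_
  · intro t ht
    have h := (hasDerivAt_iterate_log (ℓ + 1) ht).rpow_const (p := -ε)
      (Or.inl (zero_lt_one.trans_le (hL1 t ht)).ne')
    refine h.neg.congr_deriv ?_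
    ring
  · intro t ht
    simp only [Left.neg_nonpos_iff]
    exact Real.rpow_nonneg (zero_le_one.trans (hL1 t ht)) _
  · intro t ht
    have h0 : 0 ≤ t := (iterate_exp_one_pos _).le.trans ht
    exact div_nonneg (hrate.pos t h0).le h0
  · intro s t hs hst
    have hs0 : 0 < s := (iterate_exp_one_pos _).trans_le hs
    have hle : ∀ i ≤ ℓ + 1, Real.exp^[i] 1 ≤ s := fun i hi => (iterate_exp_one_mono hi).trans hs
    have hpos : ∀ i ≤ ℓ + 1, 0 < Real.log^[i] s := fun i hi =>
      zero_lt_one.trans_le (one_le_iterate_log (hle i hi))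
    have hlog : ∀ i ≤ ℓ + 1, Real.log^[i] s ≤ iterLog i t := fun i hi =>
      iterate_log_le_iterate_log i (hle i hi) (by linarith [iterate_exp_one_pos i])
    have h1 : (∏ i ∈ Finset.range (ℓ + 1), Real.log^[i] s) ≤
        t * ∏ i ∈ Finset.Icc 1 ℓ, iterLog i t := by
      -- The factor with i = 0 is s itself, to be compared with t; the others are compared with
      -- `iterLog`.
      rw [Finset.prod_range_succ', mul_comm, Function.iterate_zero, id, ← Finset.Ico_add_one_right_eq_Icc,
        Finset.prod_Ico_eq_prod_range, Nat.add_sub_cancel]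
      refine mul_le_mul hst (Finset.prod_le_prod (fun i hi => ?_) fun i hi => ?_)
        (Finset.prod_nonneg fun i hi => ?_) (hs0.le.trans hst)
      · exact (hpos _ (by simp at hi; omega)).le
      · rw [add_comm 1 i]
        exact hlog _ (by simp at hi; omega)
      · exact (hpos _ (by simp at hi; omega)).le
    have h2 : (Real.log^[ℓ + 1] s) ^ (1 + ε) ≤ iterLog (ℓ + 1) t ^ (1 + ε) :=
      Real.rpow_le_rpow (hpos _ le_rfl).le (hlog _ le_rfl) (by linarith)
    have h3 : 0 < ∏ i ∈ Finset.range (ℓ + 1), Real.log^[i] s :=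
      Finset.prod_pos fun i hi => hpos i (by simp at hi; omega)
    have h4 : 0 < (Real.log^[ℓ + 1] s) ^ (1 + ε) := Real.rpow_pos_of_pos (hpos _ le_rfl) _
    rw [show -ε - 1 = -(1 + ε) by ring, Real.rpow_neg (hpos _ le_rfl).le, mul_assoc, ← mul_inv,
      ← div_eq_mul_inv]
    unfold iterLogRate iterLogProduct
    rw [div_div]
    refine div_le_div_of_nonneg_left hε.le (mul_pos h3 h4) ?_
    calc _ ≤ (t * ∏ i ∈ Finset.Icc 1 ℓ, iterLog i t) * iterLog (ℓ + 1) t ^ (1 + ε) :=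
          mul_le_mul h1 h2 h4.le (h3.le.trans h1)
      _ = _ := by ring

end IteratedLog

/-! ### A random series with a rapidly decaying characteristic function -/

section RandomSeries

open Filter Topology

lemma norm_integral_unitInterval_exp_le {y : ℝ} (hy : y ≠ 0) :
    ‖∫ s : unitInterval, Complex.exp (y * (s : ℝ) * Complex.I)‖ ≤ min 1 (2 / |y|) := by
  have hint : ∫ s : unitInterval, Complex.exp (y * (s : ℝ) * Complex.I) =
      ∫ s in (0 : ℝ)..1, Complex.exp (y * Complex.I * s) := by
    rw [intervalIntegral.integral_of_le zero_le_one, ← integral_Icc_eq_integral_Ioc]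
    rw [← integral_subtype measurableSet_Icc]
    refine integral_congr_ae (ae_of_all _ fun s => ?_)
    simp only
    congr 1; ring
  refine le_min ?_ ?_
  · refine (norm_integral_le_of_norm_le_const (C := 1) (ae_of_all _ fun s => ?_)).trans ?_
    · rw [← Complex.ofReal_mul, Complex.norm_exp_ofReal_mul_I]
    · simp
  · rw [hint, integral_exp_mul_complex (by simpa using hy), norm_div]
    have : ‖(y : ℂ) * Complex.I‖ = |y| := by simp
    rw [this]
    gcongr
    refine (norm_sub_le _ _).trans ?_
    simp [Complex.norm_exp]
    norm_num

variable (a : ℕ → ℝ)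

/-- The sum of the series `∑ a i * w i`. -/
noncomputable def weightedSum (w : ℕ → unitInterval) : ℝ := ∑' i, a i * (w i : ℝ)

variable {a} (ha : ∀ i, 0 < a i) (hs : Summable a)

/-- The product Lebesgue measure on `[0,1]^ℕ`. -/
noncomputable abbrev cubeMeasure : Measure (ℕ → unitInterval) :=
  Measure.infinitePi fun _ => (volume : Measure unitInterval)

include ha in
lemma mul_unitInterval_le (i : ℕ) (s : unitInterval) : a i * (s : ℝ) ≤ a i :=
  mul_le_of_le_one_right (ha i).le s.2.2

include ha hs in
lemma summable_mul_unitInterval (w : ℕ → unitInterval) : Summable fun i => a i * (w i : ℝ) :=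
  hs.of_nonneg_of_le (fun i => mul_nonneg (ha i).le (w i).2.1) fun i => mul_unitInterval_le ha i _

include ha hs in
lemma weightedSum_mem (w : ℕ → unitInterval) : weightedSum a w ∈ Set.Icc 0 (∑' i, a i) :=
  ⟨tsum_nonneg fun i => mul_nonneg (ha i).le (w i).2.1,
    (summable_mul_unitInterval ha hs w).tsum_le_tsum (fun i => mul_unitInterval_le ha i _) hs⟩

include ha hs in
lemma continuous_weightedSum : Continuous (weightedSum a) := by
  refine continuous_tsum (fun i => by fun_prop) hs fun i w => ?_
  rw [Real.norm_of_nonneg (mul_nonneg (ha i).le (w i).2.1)]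
  exact mul_unitInterval_le ha i _

lemma integral_exp_partial_sum (x : ℝ) (n : ℕ) :
    ∫ w, Complex.exp ((x * ∑ i ∈ Finset.range n, a i * (w i : ℝ) : ℝ) * Complex.I) ∂cubeMeasure =
      ∏ i ∈ Finset.range n,
        ∫ s : unitInterval, Complex.exp ((x * a i : ℝ) * (s : ℝ) * Complex.I) := by
  have h := integral_restrict_infinitePi (μ := fun _ : ℕ => (volume : Measure unitInterval))
    (s := Finset.range n)
    (f := fun y => ∏ i : Finset.range n, Complex.exp ((x * a i : ℝ) * (y i : ℝ) * Complex.I))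
    (by apply Continuous.aestronglyMeasurable; fun_prop)
  rw [integral_fintype_prod_eq_prod
    (f := fun (i : Finset.range n) (s : unitInterval) => Complex.exp ((x * a i : ℝ) * (s : ℝ) * Complex.I))] at h
  rw [← Finset.prod_coe_sort, ← h]
  refine integral_congr_ae (ae_of_all _ fun w => ?_)
  simp only [Finset.restrict]
  rw [Finset.prod_coe_sort (Finset.range n)
    (fun i => Complex.exp ((x * a i : ℝ) * (w i : ℝ) * Complex.I)), ← Complex.exp_sum]
  congr 1
  push_cast
  rw [Finset.mul_sum, Finset.sum_mul]
  exact Finset.sum_congr rfl fun i _ => by ring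

include ha hs in
-- By independence the characteristic function is the limit of products of the factors of the single
-- summands. Every factor has modulus at most 1, so all beyond the n-th may be discarded.
lemma norm_integral_exp_weightedSum_le {x : ℝ} (hx : x ≠ 0) (n : ℕ) :
    ‖∫ w, Complex.exp ((x * weightedSum a w : ℝ) * Complex.I) ∂cubeMeasure‖ ≤
      ∏ i ∈ Finset.range n, min 1 (2 / |x * a i|) := by
  have hlim : Tendsto (fun k : ℕ =>
      ∫ w, Complex.exp ((x * ∑ i ∈ Finset.range k, a i * (w i : ℝ) : ℝ) * Complex.I) ∂cubeMeasure)
      atTop (𝓝 (∫ w, Complex.exp ((x * weightedSum a w : ℝ) * Complex.I) ∂cubeMeasure)) := by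
    refine tendsto_integral_of_dominated_convergence (fun _ => (1 : ℝ)) (fun k => ?_)
      (integrable_const _) (fun k => ae_of_all _ fun w => ?_) (ae_of_all _ fun w => ?_)
    · apply Continuous.aestronglyMeasurable; fun_prop
    · rw [Complex.norm_exp_ofReal_mul_I]
    · have h1 := (summable_mul_unitInterval ha hs w).hasSum.tendsto_sum_nat
      have h2 : Continuous fun r : ℝ => Complex.exp ((x * r : ℝ) * Complex.I) := by fun_prop
      exact (h2.tendsto _).comp h1
  refine le_of_tendsto hlim.norm (eventually_atTop.2 ⟨n, fun k hk => ?_⟩)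
  rw [integral_exp_partial_sum, norm_prod, ← Finset.prod_range_mul_prod_Ico _ hk]
  have hle := fun i => norm_integral_unitInterval_exp_le (mul_ne_zero hx (ha i).ne')
  refine (mul_le_of_le_one_right (Finset.prod_nonneg fun i _ => norm_nonneg _) ?_).trans ?_
  · exact Finset.prod_le_one (fun i _ => norm_nonneg _) fun i _ => (hle i).trans (min_le_left _ _)
  · exact Finset.prod_le_prod (fun i _ => norm_nonneg _) fun i _ => hle i

/-- A probability measure on `[0, ∑ a i]` whose characteristic function is dominated by all the
partial products of `min 1 (2 / |x * a i|)`. -/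
theorem exists_measure_norm_charFun_le (ha : ∀ i, 0 < a i) (hs : Summable a) :
    ∃ μ : Measure ℝ, IsProbabilityMeasure μ ∧ (∀ᵐ t ∂μ, t ∈ Set.Icc 0 (∑' i, a i)) ∧
      ∀ x : ℝ, x ≠ 0 → ∀ n : ℕ, ‖∫ t, Complex.exp ((x * t : ℝ) * Complex.I) ∂μ‖ ≤
        ∏ i ∈ Finset.range n, min 1 (2 / |x * a i|) := by
  have hc := continuous_weightedSum ha hs
  refine ⟨cubeMeasure.map (weightedSum a), Measure.isProbabilityMeasure_map hc.aemeasurable,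
    ?_, fun x hx n => ?_⟩
  · exact (ae_map_iff hc.aemeasurable (p := fun t => t ∈ Set.Icc 0 (∑' i, a i))
      measurableSet_Icc).2 (ae_of_all _ (weightedSum_mem ha hs))
  · rw [integral_map hc.aemeasurable (by apply Continuous.aestronglyMeasurable; fun_prop)]
    exact norm_integral_exp_weightedSum_le ha hs hx n

end RandomSeries

/-! ### A smooth bump with prescribed Fourier decay -/

section Bump

open Filter Topology

lemma fourier_apply_eq_integral (f : ℝ → ℂ) (x : ℝ) :
    𝓕 f x = ∫ t, Complex.exp ((-2 * Real.pi * x * t : ℝ) * Complex.I) * f t := by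
  rw [Real.fourier_real_eq_integral_exp_smul]
  refine integral_congr_ae (ae_of_all _ fun t => ?_)
  simp only [smul_eq_mul]
  congr 4
  ring

lemma fourierInv_apply_eq_integral (f : ℝ → ℂ) (x : ℝ) :
    𝓕⁻ f x = ∫ t, Complex.exp ((2 * Real.pi * x * t : ℝ) * Complex.I) * f t := by
  rw [Real.fourierInv_eq_fourier_neg, fourier_apply_eq_integral]
  simp only [mul_neg, neg_mul, neg_neg]

lemma integrable_exp_mul {f : ℝ → ℂ} (hf : Integrable f) (x : ℝ) :
    Integrable fun t => Complex.exp ((x * t : ℝ) * Complex.I) * f t := by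
  refine hf.bdd_mul (c := 1) ?_ (ae_of_all _ fun t => ?_)
  · apply Continuous.aestronglyMeasurable; fun_prop
  · rw [Complex.norm_exp_ofReal_mul_I]

lemma fourier_add_apply {f g : ℝ → ℂ} (hf : Integrable f) (hg : Integrable g) (x : ℝ) :
    𝓕 (fun t => f t + g t) x = 𝓕 f x + 𝓕 g x := by
  simp only [fourier_apply_eq_integral, mul_add]
  exact integral_add (integrable_exp_mul hf _) (integrable_exp_mul hg _)

lemma fourier_const_mul_apply (c : ℂ) (f : ℝ → ℂ) (x : ℝ) :
    𝓕 (fun t => c * f t) x = c * 𝓕 f x := by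
  simp only [fourier_apply_eq_integral, mul_left_comm _ c]
  exact integral_const_mul _ _

lemma norm_fourier_le_integral_norm (f : ℝ → ℂ) (x : ℝ) : ‖𝓕 f x‖ ≤ ∫ t, ‖f t‖ := by
  rw [fourier_apply_eq_integral]
  refine (norm_integral_le_integral_norm _).trans_eq ?_
  simp only [norm_mul, Complex.norm_exp_ofReal_mul_I, one_mul]

/-- The Fourier transform of a dilated function. -/
lemma fourier_comp_mul_apply (f : ℝ → ℂ) {c : ℝ} (hc : c ≠ 0) (x : ℝ) :
    𝓕 (fun t => f (c * t)) x = |c⁻¹| * 𝓕 f (c⁻¹ * x) := by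
  have h := Measure.integral_comp_mul_left
    (fun t => Complex.exp ((-2 * Real.pi * (c⁻¹ * x) * t : ℝ) * Complex.I) * f t) c
  rw [fourier_apply_eq_integral, fourier_apply_eq_integral, ← Complex.real_smul, ← h]
  refine integral_congr_ae (ae_of_all _ fun t => ?_)
  simp only
  congr 4
  field_simp

lemma exists_measure_charFun_decay {m : ℝ → ℝ} (hm : IsDecayRate m)
    (hsum : Summable fun n : ℕ => m n / n) {δ : ℝ} (hδ : 0 < δ) :
    ∃ μ : Measure ℝ, IsProbabilityMeasure μ ∧ (∀ᵐ t ∂μ, t ∈ Set.Icc 0 δ) ∧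
      ∃ C : ℝ, ∀ x : ℝ, ‖∫ t, Complex.exp ((-2 * Real.pi * x * t : ℝ) * Complex.I) ∂μ‖ ≤
        C * Real.exp (-(countBelow m |x| : ℝ)) := by
  -- Dropping the first k terms shrinks the support into [0, δ] at the cost of a constant factor exp
  -- k.
  obtain ⟨k, hk⟩ : ∃ k : ℕ, ∑' i : ℕ, Real.exp 1 * (m (i + k : ℕ) / (i + k : ℕ)) < δ := by
    have := tendsto_sum_nat_add fun n : ℕ => Real.exp 1 * (m n / n)
    exact (this.eventually_lt_const hδ).exists
  -- The extra shift by 1 keeps the index positive even when k = 0, so that every `a i` is positive.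
  set a : ℕ → ℝ := fun i => Real.exp 1 * (m (i + 1 + k : ℕ) / (i + 1 + k : ℕ)) with ha_def
  have hs' : Summable fun i : ℕ => Real.exp 1 * (m (i + k : ℕ) / (i + k : ℕ)) :=
    ((summable_nat_add_iff k).2 hsum).mul_left _
  have hnn : ∀ i : ℕ, 0 ≤ Real.exp 1 * (m (i + k : ℕ) / (i + k : ℕ)) := fun i => by
    have := (hm.pos (i + k : ℕ) (by positivity)).le
    positivity
  have hs : Summable a := (summable_nat_add_iff 1).2 hs'
  have ha : ∀ i, 0 < a i := fun i => by
    have := hm.pos (i + 1 + k : ℕ) (by positivity)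
    have h2 : (0 : ℝ) < (i + 1 + k : ℕ) := by exact_mod_cast (by omega)
    positivity
  have hle : ∑' i, a i ≤ δ := by
    rw [hs'.tsum_eq_zero_add] at hk
    linarith [hnn 0]
  obtain ⟨μ, hμ, hsupp, hchar⟩ := exists_measure_norm_charFun_le ha hs
  refine ⟨μ, hμ, hsupp.mono fun t ht => ⟨ht.1, ht.2.trans hle⟩, Real.exp k, fun x => ?_⟩
  rw [← Real.exp_add]
  rcases eq_or_ne x 0 with rfl | hx
  · have h0 : countBelow m |0| = 0 := by
      have := hm.countBelow_le (t := 0) le_rfl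
      rw [zero_mul] at this
      rw [abs_zero]
      exact_mod_cast this.antisymm (by positivity)
    rw [h0]
    simp
  refine (hchar (-2 * Real.pi * x) (by simp [hx, Real.pi_ne_zero])
    (countBelow m |x| - k)).trans ?_
  -- For each index j = i + 1 + k ≤ N(|x|), |x| m(j)/j ≥ 1, so 2π|x| a_i ≥ 2πe and the factor is at
  -- most 1/(πe) ≤ 1/e. If N(|x|) ≤ k, the truncated subtraction leaves an empty product, and the
  -- bound still holds.
  calc _ ≤ ∏ i ∈ Finset.range (countBelow m |x| - k), Real.exp (-1) := by
        refine Finset.prod_le_prod (fun i _ => by positivity) fun i hi => ?_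
        rw [Finset.mem_range] at hi
        refine (min_le_right _ _).trans ?_
        have h1 := hm.le_of_le_countBelow (abs_nonneg x) (j := i + 1 + k) (by omega)
        have h2 : (0 : ℝ) < (i + 1 + k : ℕ) := by exact_mod_cast (by omega)
        have h3 : Real.exp 1 ≤ |x| * a i := by
          have : 1 ≤ |x| * m (i + 1 + k : ℕ) / (i + 1 + k : ℕ) := (one_le_div h2).2 h1
          calc Real.exp 1 = Real.exp 1 * 1 := by ring
            _ ≤ Real.exp 1 * (|x| * m (i + 1 + k : ℕ) / (i + 1 + k : ℕ)) := by gcongr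
            _ = _ := by rw [ha_def]; ring
        have h4 : |-2 * Real.pi * x * a i| = 2 * Real.pi * (|x| * a i) := by
          rw [abs_mul, abs_mul, abs_mul, abs_neg, abs_two, abs_of_pos Real.pi_pos,
            abs_of_pos (ha i)]
          ring
        rw [h4, Real.exp_neg, div_le_iff₀ (mul_pos (by positivity) (mul_pos (abs_pos.2 hx) (ha i))), ← div_eq_inv_mul,
          le_div_iff₀ (Real.exp_pos _)]
        nlinarith [Real.pi_gt_three, Real.exp_pos 1]
    _ = Real.exp (-((countBelow m |x| - k : ℕ) : ℝ)) := by
        rw [Finset.prod_const, Finset.card_range, ← Real.exp_nat_mul]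
        congr 1; ring
    _ ≤ _ := by
        rw [Real.exp_le_exp]
        have : (countBelow m |x| : ℝ) ≤ (countBelow m |x| - k : ℕ) + (k : ℝ) := by
          exact_mod_cast (by omega)
        linarith

lemma SchwartzMap.exists_norm_le_inv_one_add_sq (F : 𝓢(ℝ, ℂ)) :
    ∃ C : ℝ, ∀ x, ‖F x‖ ≤ C * (1 + x ^ 2)⁻¹ := by
  obtain ⟨C₀, _, h0⟩ := F.decay 0 0
  obtain ⟨C₁, _, h1⟩ := F.decay 2 0
  refine ⟨C₀ + C₁, fun x => ?_⟩
  have h0 := h0 x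
  have h1 := h1 x
  simp only [pow_zero, one_mul, norm_iteratedFDeriv_zero, Real.norm_eq_abs, sq_abs] at h0 h1
  rw [← div_eq_mul_inv, le_div_iff₀ (by positivity)]
  nlinarith

lemma exists_fourier_decay_of_contDiff {f : ℝ → ℂ} (hf : ContDiff ℝ ∞ f)
    (hc : HasCompactSupport f) : ∃ C : ℝ, ∀ x, ‖𝓕 f x‖ ≤ C * (1 + x ^ 2)⁻¹ :=
  (𝓕 (hc.toSchwartzMap hf)).exists_norm_le_inv_one_add_sq

/-- The Fourier transform of the convolution of a measure with a function. -/
lemma fourier_integral_comp_sub {μ : Measure ℝ} [IsFiniteMeasure μ] {ρ : ℝ → ℂ}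
    (hρ : Integrable ρ) (x : ℝ) :
    𝓕 (fun y => ∫ t, ρ (y - t) ∂μ) x =
      (∫ t, Complex.exp ((-2 * Real.pi * x * t : ℝ) * Complex.I) ∂μ) * 𝓕 ρ x := by
  rw [Real.fourier_eq', Real.fourier_eq', ← integral_mul_const]
  have hF : Integrable (fun p : ℝ × ℝ =>
      Complex.exp ((-2 * Real.pi * inner ℝ p.1 x : ℝ) * Complex.I) • ρ (p.1 - p.2))
      (volume.prod μ) := by
    have h1 : Integrable (fun p : ℝ × ℝ => ρ (p.1 - p.2)) (volume.prod μ) := by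
      have := (integrable_const (1 : ℂ) (μ := μ)).convolution_integrand
        (ContinuousLinearMap.mul ℝ ℂ) hρ
      simpa using this
    refine h1.bdd_mul (c := 1) ?_ (ae_of_all _ fun p => ?_)
    · apply Continuous.aestronglyMeasurable; fun_prop
    · rw [Complex.norm_exp_ofReal_mul_I]
  simp only [← integral_smul]
  rw [integral_integral_swap hF]
  refine integral_congr_ae (ae_of_all _ fun t => ?_)
  simp only
  rw [← integral_add_right_eq_self _ t, ← integral_const_mul]
  refine integral_congr_ae (ae_of_all _ fun y => ?_)
  simp only [add_sub_cancel_right, smul_eq_mul]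
  rw [← mul_assoc, ← Complex.exp_add]
  congr 2
  simp
  ring

/-- A smooth probability density on `[1/3, 2/3]`, symmetric about `1/2`, whose Fourier transform is
dominated by the weight. -/
theorem exists_symmetric_bump {m : ℝ → ℝ} (hm : IsDecayRate m)
    (hsum : Summable fun n : ℕ => m n / n) :
    ∃ g : ℝ → ℝ, ContDiff ℝ ∞ g ∧ (∀ t, t ∉ Set.Icc (1 / 3 : ℝ) (2 / 3) → g t = 0) ∧
      (∀ t, g (1 - t) = g t) ∧ ∫ t, g t = 1 ∧
      ∃ C : ℝ, ∀ x, ‖𝓕 (fun t => (g t : ℂ)) x‖ ≤ C * decayWeight m x := by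
  obtain ⟨μ, hμ, hsupp, C₁, hC₁⟩ := exists_measure_charFun_decay hm hsum
    (δ := 1 / 12) (by norm_num)
  let B : ContDiffBump (1 / 2 : ℝ) := ⟨1 / 24, 1 / 12, by norm_num, by norm_num⟩
  set ρ : ℝ → ℝ := B.normed volume with hρ
  have hρs : ContDiff ℝ ∞ ρ := B.contDiff_normed
  have hρc : HasCompactSupport ρ := B.hasCompactSupport_normed
  have hρi : Integrable ρ := hρs.continuous.integrable_of_hasCompactSupport hρc
  have hρ0 : ∀ t, t ∉ Set.Ioo (5 / 12 : ℝ) (7 / 12) → ρ t = 0 := by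
    intro t ht
    have : t ∉ Function.support ρ := by
      rw [hρ, B.support_normed_eq, Real.ball_eq_Ioo]
      convert ht using 3 <;> norm_num [B]
    simpa using this
  -- In the convolution of `μ` with `ρ`, the measure contributes the factor exp(-N) to the
  -- transform, while `ρ` contributes smoothness and the factor 1/(1 + x²). The supports [0, 1/12]
  -- and (5/12, 7/12) add up to a subset of [1/3, 2/3].
  set f : ℝ → ℝ := fun y => ∫ t, ρ (y - t) ∂μ with hf
  have hfs : ContDiff ℝ ∞ f := by
    have := hρc.contDiff_convolution_right (n := ⊤) (μ := μ) (f := fun _ => (1 : ℝ))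
      (ContinuousLinearMap.mul ℝ ℝ) (locallyIntegrable_const _) hρs
    convert this using 1
    ext y
    simp [hf, convolution_def]
  have hf0 : ∀ t, t ∉ Set.Icc (1 / 3 : ℝ) (2 / 3) → f t = 0 := by
    intro y hy
    refine integral_eq_zero_of_ae (hsupp.mono fun t ht => hρ0 _ fun h => hy ?_)
    exact ⟨by linarith [h.1, ht.1], by linarith [h.2, ht.2]⟩
  have hfi : Integrable f := hfs.continuous.integrable_of_hasCompactSupport
    (HasCompactSupport.intro isCompact_Icc hf0)
  have hf1 : ∫ t, f t = 1 := by
    rw [hf, integral_integral_swap]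
    · simp only [integral_sub_right_eq_self]
      rw [hρ, B.integral_normed]
      simp
    · have := (integrable_const (1 : ℝ) (μ := μ)).convolution_integrand
        (ContinuousLinearMap.mul ℝ ℝ) hρi
      simpa [Function.uncurry_def] using this
  obtain ⟨C₂, hC₂⟩ := exists_fourier_decay_of_contDiff (f := fun t => (ρ t : ℂ))
    (Complex.ofRealCLM.contDiff.comp hρs) (hρc.comp_left Complex.ofReal_zero)
  have hdec : ∀ x, ‖𝓕 (fun t => (f t : ℂ)) x‖ ≤ C₁ * C₂ * decayWeight m x := by
    intro x
    have : (fun t => (f t : ℂ)) = fun y => ∫ t, (ρ (y - t) : ℂ) ∂μ := by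
      ext y
      exact integral_ofReal.symm
    rw [this, fourier_integral_comp_sub (ρ := fun t => (ρ t : ℂ)) hρi.ofReal, norm_mul]
    calc _ ≤ (C₁ * Real.exp (-(countBelow m |x| : ℝ))) * (C₂ * (1 + x ^ 2)⁻¹) :=
          mul_le_mul (hC₁ x) (hC₂ x) (norm_nonneg _) ((norm_nonneg _).trans (hC₁ x))
      _ = _ := by unfold decayWeight; ring
  have hrefl : ∀ x, 𝓕 (fun t => (f (1 - t) : ℂ)) x =
      Complex.exp ((-2 * Real.pi * x : ℝ) * Complex.I) * 𝓕 (fun t => (f t : ℂ)) (-x) := by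
    intro x
    rw [Real.fourier_eq', Real.fourier_eq', ← integral_const_mul]
    rw [← integral_sub_left_eq_self _ volume 1]
    refine integral_congr_ae (ae_of_all _ fun y => ?_)
    simp only [sub_sub_cancel, smul_eq_mul]
    rw [← mul_assoc, ← Complex.exp_add]
    congr 2
    simp
    ring
  -- Reflection about 1/2 changes the transform only by a unimodular factor and x ↦ -x. The weight
  -- is even, so averaging keeps the constant.
  refine ⟨fun t => (f t + f (1 - t)) / 2, ?_, ?_, ?_, ?_, C₁ * C₂, fun x => ?_⟩
  · fun_prop
  · intro t ht
    simp only
    rw [hf0 t ht, hf0 (1 - t) fun h => ht ⟨by linarith [h.2], by linarith [h.1]⟩]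
    simp
  · intro t
    simp only [sub_sub_cancel]
    ring
  · rw [integral_div, integral_add hfi (hfi.comp_sub_left 1),
      integral_sub_left_eq_self f volume 1, hf1]
    norm_num
  · have h1 : 𝓕 (fun t => (((f t + f (1 - t)) / 2 : ℝ) : ℂ)) x =
        (𝓕 (fun t => (f t : ℂ)) x + 𝓕 (fun t => (f (1 - t) : ℂ)) x) / 2 := by
      rw [← fourier_add_apply (f := fun t => (f t : ℂ)) (g := fun t => (f (1 - t) : ℂ))
        hfi.ofReal (hfi.comp_sub_left 1).ofReal, div_eq_inv_mul,
        ← fourier_const_mul_apply]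
      refine congrArg (fun F : ℝ → ℂ => 𝓕 F x) (funext fun t => ?_)
      push_cast
      ring
    rw [h1, hrefl, norm_div]
    have h2 := norm_add_le (𝓕 (fun t => (f t : ℂ)) x)
      (Complex.exp ((-2 * Real.pi * x : ℝ) * Complex.I) * 𝓕 (fun t => (f t : ℂ)) (-x))
    rw [norm_mul, Complex.norm_exp_ofReal_mul_I, one_mul] at h2
    have h3 := hdec (-x)
    have h4 := decayWeight_neg m x
    rw [h4] at h3
    rw [show ‖(2 : ℂ)‖ = 2 by simp, div_le_iff₀ two_pos]
    linarith [hdec x]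

end Bump

/-! ### The angle function of a Meyer wavelet -/

section Angle

open Filter Topology intervalIntegral

variable {g : ℝ → ℝ} (hg : ContDiff ℝ ∞ g)
  (hg0 : ∀ t, t ∉ Set.Icc (1 / 3 : ℝ) (2 / 3) → g t = 0)
  (hgs : ∀ t, g (1 - t) = g t) (hg1 : ∫ t, g t = 1)

/-- The difference `G x - G (x / 2)`, where `G` is the primitive of `g` vanishing at `0`. -/
noncomputable def bumpAngle (g : ℝ → ℝ) (x : ℝ) : ℝ :=
  (∫ t in (0 : ℝ)..x, g t) - ∫ t in (0 : ℝ)..x / 2, g t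

include hg0 in
lemma primitive_eq_zero {x : ℝ} (hx : x ≤ 1 / 3) : ∫ t in (0 : ℝ)..x, g t = 0 := by
  refine intervalIntegral.integral_zero_ae ?_
  have h : ∀ᵐ t : ℝ, t ≠ 1 / 3 := by simp [ae_iff]
  refine h.mono fun t ht hmem => hg0 t fun h => ?_
  rcases Set.mem_uIoc.1 hmem with h' | h'
  · exact ht (le_antisymm (h'.2.trans hx) h.1)
  · linarith [h'.2, h.1]

include hg0 hg1 in
lemma primitive_eq_one {x : ℝ} (hx : 2 / 3 ≤ x) : ∫ t in (0 : ℝ)..x, g t = 1 := by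
  rw [← hg1, intervalIntegral.integral_of_le (by linarith)]
  refine setIntegral_eq_integral_of_forall_compl_eq_zero fun t ht => hg0 t fun h => ht ?_
  exact ⟨by linarith [h.1], h.2.trans hx⟩

include hg hg0 hgs hg1 in
lemma primitive_add_reflect (x : ℝ) :
    (∫ t in (0 : ℝ)..x, g t) + ∫ t in (0 : ℝ)..(1 - x), g t = 1 := by
  have h1 : ∫ t in (0 : ℝ)..(1 - x), g t = ∫ t in x..1, g t := by
    have h := intervalIntegral.integral_comp_sub_left g 1 (a := x) (b := 1)
    simp only [hgs, sub_self] at h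
    exact h.symm
  rw [h1, intervalIntegral.integral_add_adjacent_intervals (hg.continuous.intervalIntegrable _ _)
    (hg.continuous.intervalIntegrable _ _)]
  exact primitive_eq_one hg0 hg1 (by norm_num)

include hg in
lemma hasDerivAt_primitive (x : ℝ) : HasDerivAt (fun x => ∫ t in (0 : ℝ)..x, g t) (g x) x :=
  intervalIntegral.integral_hasDerivAt_right (hg.continuous.intervalIntegrable _ _)
    (hg.continuous.stronglyMeasurableAtFilter _ _) hg.continuous.continuousAt

include hg in
lemma contDiff_primitive : ContDiff ℝ ∞ fun x => ∫ t in (0 : ℝ)..x, g t := by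
  rw [contDiff_infty_iff_deriv]
  refine ⟨fun x => (hasDerivAt_primitive hg x).differentiableAt, ?_⟩
  rwa [funext fun x => (hasDerivAt_primitive hg x).deriv]

include hg in
lemma contDiff_bumpAngle : ContDiff ℝ ∞ (bumpAngle g) := by
  have h := contDiff_primitive hg
  exact h.sub (h.comp (contDiff_id.div_const 2))

include hg in
lemma hasDerivAt_bumpAngle (x : ℝ) : HasDerivAt (bumpAngle g) (g x - g (x / 2) / 2) x := by
  have h := (hasDerivAt_primitive hg (x / 2)).comp x ((hasDerivAt_id x).div_const 2)
  refine ((hasDerivAt_primitive hg x).sub h).congr_deriv ?_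
  ring

include hg0 hg1 in
lemma bumpAngle_eq_zero {x : ℝ} (hx : x ∉ Set.Ioo (1 / 3 : ℝ) (4 / 3)) : bumpAngle g x = 0 := by
  unfold bumpAngle
  rcases le_or_gt x (1 / 3) with h | h
  · rw [primitive_eq_zero hg0 h, primitive_eq_zero hg0 (by linarith), sub_zero]
  · have h2 : 4 / 3 ≤ x := not_lt.1 fun h' => hx ⟨h, h'⟩
    rw [primitive_eq_one hg0 hg1 (by linarith), primitive_eq_one hg0 hg1 (by linarith),
      sub_self]

include hg0 hg1 in
-- On this interval the angle at x is G(x) and the angle at 2x is 1 - G(x), since G is 0 up to 1/3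
-- and 1 from 2/3 on.
lemma bumpAngle_add_two_mul {x : ℝ} (hx : x ∈ Set.Icc (1 / 3 : ℝ) (2 / 3)) :
    bumpAngle g x + bumpAngle g (2 * x) = 1 := by
  unfold bumpAngle
  rw [primitive_eq_zero hg0 (x := x / 2) (by linarith [hx.2]),
    primitive_eq_one hg0 hg1 (x := 2 * x) (by linarith [hx.1]),
    mul_div_cancel_left₀ x two_ne_zero]
  ring

include hg hg0 hgs hg1 in
lemma bumpAngle_add_reflect {x : ℝ} (hx : x ∈ Set.Icc (1 / 3 : ℝ) (2 / 3)) :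
    bumpAngle g x + bumpAngle g (1 - x) = 1 := by
  unfold bumpAngle
  rw [primitive_eq_zero hg0 (x := x / 2) (by linarith [hx.2]),
    primitive_eq_zero hg0 (x := (1 - x) / 2) (by linarith [hx.1]), sub_zero, sub_zero]
  exact primitive_add_reflect hg hg0 hgs hg1 x

/-- If the derivative of a compactly supported `f` has Fourier transform dominated by the weight,
so has `f`. -/
lemma fourier_decay_of_deriv {m : ℝ → ℝ} (hm : IsDecayRate m) {f : ℝ → ℂ}
    (hf : ContDiff ℝ ∞ f) (hc : HasCompactSupport f) {C : ℝ}
    (hC : ∀ x, ‖𝓕 (deriv f) x‖ ≤ C * decayWeight m x) :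
    ∃ C' : ℝ, ∀ x, ‖𝓕 f x‖ ≤ C' * decayWeight m x := by
  have hC0 : 0 ≤ C :=
    nonneg_of_mul_nonneg_left ((norm_nonneg _).trans (hC 0)) (IsDecayRate.decayWeight_pos 0)
  have hfi := hf.continuous.integrable_of_hasCompactSupport hc (μ := volume)
  have hfi' := ((hf.continuous_deriv (by simp)).integrable_of_hasCompactSupport hc.deriv
    (μ := volume))
  have hder := Real.fourier_deriv hfi (hf.differentiable (by simp)) hfi'
  set M := ∫ t, ‖f t‖
  have hM : 0 ≤ M := integral_nonneg fun t => norm_nonneg _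
  refine ⟨C + 2 * M * Real.exp (countBelow m 1), fun x => ?_⟩
  have hw := IsDecayRate.decayWeight_pos (m := m) x
  rw [add_mul]
  -- For |x| ≥ 1 the factor |2πx| ≥ 1 relating the two transforms works in favour of `f`. For |x| ≤
  -- 1 the weight is bounded below, and the L¹ norm of `f` suffices.
  rcases le_total 1 |x| with hx | hx
  · refine le_trans ?_ (le_add_of_nonneg_right (by positivity))
    refine le_trans ?_ (hC x)
    rw [hder]
    simp only [norm_smul, norm_mul, Complex.norm_I, Complex.norm_real, Real.norm_eq_abs,
      abs_of_pos Real.pi_pos, Complex.norm_ofNat, mul_one]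
    refine le_mul_of_one_le_left (norm_nonneg _) ?_
    nlinarith [Real.pi_gt_three]
  · refine le_trans ?_ (le_add_of_nonneg_left (by positivity))
    refine (norm_fourier_le_integral_norm f x).trans ?_
    have h1 : (countBelow m |x| : ℝ) ≤ countBelow m 1 := by
      exact_mod_cast hm.countBelow_mono (abs_nonneg x) hx
    have h2 : 1 ≤ Real.exp (countBelow m 1) * Real.exp (-(countBelow m |x| : ℝ)) := by
      rw [← Real.exp_add, Real.one_le_exp_iff]; linarith
    have h3 : 1 ≤ 2 * (1 + x ^ 2)⁻¹ := by
      rw [← div_eq_mul_inv, one_le_div (by positivity)]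
      nlinarith [sq_abs x, abs_nonneg x]
    calc M = M * 1 * 1 := by ring
      _ ≤ M * (2 * (1 + x ^ 2)⁻¹) *
          (Real.exp (countBelow m 1) * Real.exp (-(countBelow m |x| : ℝ))) := by gcongr
      _ = _ := by unfold decayWeight; ring

end Angle

/-- An angle function `Φ` for a Meyer wavelet: `sin (π / 2 * Φ)` is the modulus of its Fourier
transform. -/
structure IsMeyerAngle (Φ : ℝ → ℝ) : Prop where
  contDiff : ContDiff ℝ ∞ Φ
  even : ∀ x, Φ (-x) = Φ x
  eq_zero : ∀ x, |x| ∉ Set.Ioo (1 / 3 : ℝ) (4 / 3) → Φ x = 0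
  add_two_mul : ∀ x ∈ Set.Icc (1 / 3 : ℝ) (2 / 3), Φ x + Φ (2 * x) = 1
  add_reflect : ∀ x ∈ Set.Icc (1 / 3 : ℝ) (2 / 3), Φ x + Φ (1 - x) = 1

lemma IsMeyerAngle.hasCompactSupport {Φ : ℝ → ℝ} (h : IsMeyerAngle Φ) : HasCompactSupport Φ :=
  HasCompactSupport.intro (isCompact_Icc (a := -(4 / 3 : ℝ)) (b := 4 / 3)) fun x hx =>
    h.eq_zero x fun h' => hx (abs_le.1 h'.2.le)

theorem exists_meyerAngle {m : ℝ → ℝ} (hm : IsDecayRate m)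
    (hsum : Summable fun n : ℕ => m n / n) :
    ∃ Φ : ℝ → ℝ, IsMeyerAngle Φ ∧
      ∃ C : ℝ, ∀ x, ‖𝓕 (fun t => (Φ t : ℂ)) x‖ ≤ C * decayWeight m x := by
  obtain ⟨g, hg, hg0, hgs, hg1, C, hC⟩ := exists_symmetric_bump hm hsum
  set φ := bumpAngle g with hφ
  have hφs : ContDiff ℝ ∞ φ := contDiff_bumpAngle hg
  have hφ0 : ∀ x, x ∉ Set.Ioo (1 / 3 : ℝ) (4 / 3) → φ x = 0 := fun x hx =>
    bumpAngle_eq_zero hg0 hg1 hx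
  have hneg : ∀ x : ℝ, 0 ≤ x → φ (-x) = 0 := fun x hx => hφ0 _ fun h => by linarith [h.1]
  have hφc : HasCompactSupport φ := HasCompactSupport.intro (isCompact_Icc (a := (1 / 3 : ℝ))
    (b := 4 / 3)) fun x hx => hφ0 x fun h => hx ⟨h.1.le, h.2.le⟩
  have hφi : Integrable φ := hφs.continuous.integrable_of_hasCompactSupport hφc
  have hgi : Integrable g := hg.continuous.integrable_of_hasCompactSupport
    (HasCompactSupport.intro isCompact_Icc hg0)
  have hCnn : 0 ≤ C :=
    nonneg_of_mul_nonneg_left ((norm_nonneg _).trans (hC 0)) (IsDecayRate.decayWeight_pos 0)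
  obtain ⟨C', hC'⟩ := fourier_decay_of_deriv hm (f := fun t => (φ t : ℂ)) (C := 2 * C)
    (Complex.ofRealCLM.contDiff.comp hφs) (hφc.comp_left Complex.ofReal_zero) (by
      intro x
      have hd : deriv (fun t => (φ t : ℂ)) =
          fun t => (g t : ℂ) + (-1 / 2 : ℂ) * (g (2⁻¹ * t) : ℂ) := by
        ext t
        rw [((hasDerivAt_bumpAngle hg t).ofReal_comp).deriv]
        push_cast
        rw [div_eq_inv_mul t]
        ring
      have hi2 : Integrable fun t : ℝ => (g (2⁻¹ * t) : ℂ) :=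
        (hgi.comp_mul_left' (by norm_num)).ofReal
      rw [hd, fourier_add_apply (f := fun t => (g t : ℂ)) hgi.ofReal (hi2.const_mul _),
        fourier_const_mul_apply,
        fourier_comp_mul_apply (fun t => (g t : ℂ)) (c := 2⁻¹) (by norm_num), inv_inv]
      refine (norm_add_le _ _).trans ?_
      have h1 := hC x
      have h2 := (hC (2 * x)).trans
        (mul_le_mul_of_nonneg_left (hm.decayWeight_two_mul_le x) hCnn)
      have h3 : ‖(-1 / 2 : ℂ) * ((|(2 : ℝ)| : ℝ) * 𝓕 (fun t => (g t : ℂ)) (2 * x))‖ =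
          ‖𝓕 (fun t => (g t : ℂ)) (2 * x)‖ := by
        simp
      rw [h3]
      linarith)
  refine ⟨fun x => φ x + φ (-x), ⟨?_, ?_, ?_, ?_, ?_⟩, 2 * C', fun x => ?_⟩
  · fun_prop
  · intro x; simp [add_comm]
  · intro x hx
    rcases le_total 0 x with h | h
    · rw [abs_of_nonneg h] at hx
      rw [hφ0 x hx, hneg x h, add_zero]
    · rw [abs_of_nonpos h] at hx
      have := hneg (-x) (by linarith)
      rw [neg_neg] at this
      rw [hφ0 _ hx, this, add_zero]
  · intro x hx
    rw [hneg x (by linarith [hx.1]), hneg (2 * x) (by linarith [hx.1]), add_zero, add_zero]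
    exact bumpAngle_add_two_mul hg0 hg1 hx
  · intro x hx
    rw [hneg x (by linarith [hx.1]), hneg (1 - x) (by linarith [hx.2]), add_zero, add_zero]
    exact bumpAngle_add_reflect hg hg0 hgs hg1 hx
  · have h1 : (fun t => ((φ t + φ (-t) : ℝ) : ℂ)) =
        fun t => (φ t : ℂ) + (φ (-1 * t) : ℂ) := by
      ext t; push_cast; simp
    rw [h1, fourier_add_apply (f := fun t => (φ t : ℂ)) (g := fun t => (φ (-1 * t) : ℂ))
      hφi.ofReal (hφi.comp_mul_left' (by norm_num)).ofReal,
      fourier_comp_mul_apply (fun t => (φ t : ℂ)) (c := -1) (by norm_num)]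
    refine (norm_add_le _ _).trans ?_
    have h2 := hC' (-x)
    have h3 := decayWeight_neg m x
    rw [h3] at h2
    have h4 : ‖((|(-1 : ℝ)⁻¹| : ℝ) : ℂ) * 𝓕 (fun t => (φ t : ℂ)) ((-1)⁻¹ * x)‖ =
        ‖𝓕 (fun t => (φ t : ℂ)) (-x)‖ := by
      simp [inv_neg]
    rw [h4]
    linarith [hC' x]

/-! ### Superposition with the sine in a weighted Fourier algebra -/

section Superposition

/-- The inverse Fourier transform of a product of Schwartz functions is a convolution. -/
lemma SchwartzMap.fourierInv_mul_apply (u v : 𝓢(ℝ, ℂ)) (x : ℝ) :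
    𝓕⁻ (fun t => u t * v t) x = ∫ t, 𝓕⁻ u t * 𝓕⁻ v (x - t) := by
  have h1 := SchwartzMap.fourier_convolution (ContinuousLinearMap.mul ℂ ℂ) (𝓕⁻ u) (𝓕⁻ v)
  have h2 := congrArg (fun F : 𝓢(ℝ, ℂ) => 𝓕⁻ F x) h1
  simp only [FourierTransform.fourier_fourierInv_eq, FourierTransform.fourierInv_fourier_eq] at h2
  rw [SchwartzMap.convolution_apply, convolution_def] at h2
  rw [SchwartzMap.fourierInv_coe (SchwartzMap.pairing _ _ _)] at h2
  exact h2.symm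

variable {m : ℝ → ℝ} (hm : IsDecayRate m) {f : ℝ → ℂ} (hf : ContDiff ℝ ∞ f)
  (hc : HasCompactSupport f) {C : ℝ} (hC : ∀ x, ‖𝓕⁻ f x‖ ≤ C * decayWeight m x)

include hm hf hc hC in
-- Each multiplication by `f` is a convolution on the other side and costs a factor 4πeC. The first
-- power is given a superfluous factor 4πe so that the bound is purely geometric.
lemma norm_fourierInv_pow_le (n : ℕ) (x : ℝ) :
    ‖𝓕⁻ (fun t => f t ^ (n + 1)) x‖ ≤
      (C * (4 * Real.exp 1 * Real.pi)) ^ (n + 1) * decayWeight m x := by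
  have hC0 : 0 ≤ C :=
    nonneg_of_mul_nonneg_left ((norm_nonneg _).trans (hC 0)) (IsDecayRate.decayWeight_pos 0)
  have hK : 1 ≤ 4 * Real.exp 1 * Real.pi := by
    nlinarith [Real.pi_gt_three, Real.add_one_le_exp (1 : ℝ)]
  induction n generalizing x with
  | zero =>
    simp only [zero_add, pow_one]
    refine (hC x).trans ?_
    have := (IsDecayRate.decayWeight_pos (m := m) x).le
    gcongr
    exact le_mul_of_one_le_right hC0 hK
  | succ n ih =>
    have hcn : HasCompactSupport fun t => f t ^ (n + 1) :=
      hc.comp_left (g := fun z : ℂ => z ^ (n + 1)) (by simp)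
    have h := SchwartzMap.fourierInv_mul_apply
      (hcn.toSchwartzMap (hf.pow (n + 1))) (hc.toSchwartzMap hf) x
    have e : (fun t => f t ^ (n + 1 + 1)) = fun t =>
        (hcn.toSchwartzMap (hf.pow (n + 1))) t * (hc.toSchwartzMap hf) t := by
      ext t; exact pow_succ _ _
    rw [e, h]
    refine (hm.norm_convolution_le (A := (C * (4 * Real.exp 1 * Real.pi)) ^ (n + 1)) (B := C)
      (fun y => ?_) (fun y => ?_) x).trans_eq ?_
    · rw [SchwartzMap.fourierInv_coe]; exact ih y
    · rw [SchwartzMap.fourierInv_coe]; exact hC y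
    · ring

include hm hf hc hC in
-- The sine is expanded in its power series and transformed termwise. The geometric bounds on powers
-- sum to a hyperbolic sine, which is finite whatever the size of C.
theorem exists_fourierInv_sin_decay (r : ℝ) :
    ∃ C' : ℝ, ∀ x, ‖𝓕⁻ (fun t => Complex.sin (r * f t)) x‖ ≤ C' * decayWeight m x := by
  set L := C * (4 * Real.exp 1 * Real.pi) with hL
  -- Taking M ≥ 1 allows the bound M^(2n) to be raised to M^(2n+1), matching the series of sinh(|r|
  -- M), which dominates the L¹ norms and justifies the interchange of sum and integral.
  obtain ⟨M, hM1, hM⟩ : ∃ M : ℝ, 1 ≤ M ∧ ∀ t, ‖f t‖ ≤ M := by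
    obtain ⟨M, hM⟩ := hc.exists_bound_of_continuous hf.continuous
    exact ⟨max M 1, le_max_right _ _, fun t => (hM t).trans (le_max_left _ _)⟩
  have hfi : Integrable f := hf.continuous.integrable_of_hasCompactSupport hc
  refine ⟨Real.sinh (|r| * L), fun x => ?_⟩
  set c : ℕ → ℂ := fun n => (-1) ^ n * (r : ℂ) ^ (2 * n + 1) / (2 * n + 1).factorial with hc_def
  have hcn : ∀ n, ‖c n‖ = |r| ^ (2 * n + 1) / (2 * n + 1).factorial := fun n => by
    simp [hc_def]
  set F : ℕ → ℝ → ℂ := fun n t =>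
    Complex.exp ((2 * Real.pi * x * t : ℝ) * Complex.I) * (c n * f t ^ (2 * n + 1)) with hF
  have hpi : ∀ n, Integrable fun t => f t ^ (2 * n + 1) := fun n =>
    (hf.continuous.pow _).integrable_of_hasCompactSupport
      (hc.comp_left (g := fun z : ℂ => z ^ (2 * n + 1)) (by simp))
  have hFi : ∀ n, Integrable (F n) := fun n => integrable_exp_mul ((hpi n).const_mul _) _
  have hFsum : Summable fun n => ∫ t, ‖F n t‖ := by
    refine Summable.of_nonneg_of_le (fun n => integral_nonneg fun t => norm_nonneg _) (fun n => ?_)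
      ((Real.hasSum_sinh (|r| * M)).summable.mul_right (∫ t, ‖f t‖))
    rw [← integral_const_mul]
    refine integral_mono (hFi n).norm (hfi.norm.const_mul _) fun t => ?_
    simp only [hF, norm_mul, Complex.norm_exp_ofReal_mul_I, one_mul, hcn, norm_pow]
    rw [mul_pow, pow_succ ‖f t‖, ← mul_assoc, mul_div_right_comm]
    have h1 : ‖f t‖ ^ (2 * n) ≤ M ^ (2 * n + 1) :=
      (pow_le_pow_left₀ (norm_nonneg _) (hM t) _).trans (pow_le_pow_right₀ hM1 (by omega))
    gcongr
  have hsum := hasSum_integral_of_summable_integral_norm hFi hFsum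
  have hval : ∫ t, ∑' n, F n t = 𝓕⁻ (fun t => Complex.sin (r * f t)) x := by
    rw [fourierInv_apply_eq_integral]
    refine integral_congr_ae (ae_of_all _ fun t => ?_)
    simp only [hF]
    rw [tsum_mul_left, ← (Complex.hasSum_sin (r * f t)).tsum_eq]
    congr 1
    refine tsum_congr fun n => ?_
    simp only [hc_def]
    rw [mul_pow]
    ring
  have hterm : ∀ n, ∫ t, F n t = c n * 𝓕⁻ (fun t => f t ^ (2 * n + 1)) x := fun n => by
    rw [fourierInv_apply_eq_integral, ← integral_const_mul]
    refine integral_congr_ae (ae_of_all _ fun t => ?_)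
    simp only [hF]
    ring
  rw [← hval, ← hsum.tsum_eq]
  refine tsum_of_norm_bounded ((Real.hasSum_sinh (|r| * L)).mul_right (decayWeight m x))
    fun n => ?_
  rw [hterm, norm_mul, hcn, mul_pow, mul_div_right_comm, mul_assoc (_ / _)]
  gcongr
  exact norm_fourierInv_pow_le hm hf hc hC (2 * n) x

end Superposition

/-- The function `ξ ↦ exp (-π i ξ) * sin (π / 2 * Φ ξ)`. -/
noncomputable def meyerFourier (Φ : ℝ → ℝ) (x : ℝ) : ℂ :=
  Complex.exp ((-Real.pi * x : ℝ) * Complex.I) * (Real.sin (Real.pi / 2 * Φ x) : ℝ)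

theorem exists_fourierInv_meyerFourier_decay {m : ℝ → ℝ} (hm : IsDecayRate m) {Φ : ℝ → ℝ}
    (hΦ : IsMeyerAngle Φ) {C : ℝ}
    (hC : ∀ x, ‖𝓕 (fun t => (Φ t : ℂ)) x‖ ≤ C * decayWeight m x) :
    ∃ C' : ℝ, ∀ x, ‖𝓕⁻ (meyerFourier Φ) x‖ ≤ C' * Real.exp (-(|x| * m |x|)) := by
  obtain ⟨A, hA⟩ := exists_fourierInv_sin_decay hm (f := fun t => (Φ t : ℂ)) (C := C)
    (Complex.ofRealCLM.contDiff.comp hΦ.contDiff) (hΦ.hasCompactSupport.comp_left Complex.ofReal_zero)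
    (fun x => by
      rw [Real.fourierInv_eq_fourier_neg, ← decayWeight_neg]
      exact hC _) (Real.pi / 2)
  have hA0 : 0 ≤ A :=
    nonneg_of_mul_nonneg_left ((norm_nonneg _).trans (hA 0)) (IsDecayRate.decayWeight_pos 0)
  refine ⟨A * (2 * Real.exp (countBelow m |1 / 2| + 1) * (1 + (1 / 2) ^ 2)) * Real.exp 1,
    fun x => ?_⟩
  have h1 : 𝓕⁻ (meyerFourier Φ) x =
      𝓕⁻ (fun t => Complex.sin ((Real.pi / 2 : ℝ) * (Φ t : ℂ))) (x - 1 / 2) := by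
    rw [fourierInv_apply_eq_integral, fourierInv_apply_eq_integral]
    refine integral_congr_ae (ae_of_all _ fun t => ?_)
    simp only [meyerFourier]
    rw [← mul_assoc, ← Complex.exp_add]
    push_cast
    congr 2
    ring
  rw [h1]
  calc _ ≤ A * decayWeight m (x - 1 / 2) := hA _
    _ ≤ A * (2 * Real.exp (countBelow m |1 / 2| + 1) * (1 + (1 / 2) ^ 2) * decayWeight m x) := by
        gcongr
        exact hm.decayWeight_sub_le x (1 / 2)
    _ ≤ A * (2 * Real.exp (countBelow m |1 / 2| + 1) * (1 + (1 / 2) ^ 2) *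
        (Real.exp 1 * Real.exp (-(|x| * m |x|)))) := by
        gcongr
        exact hm.decayWeight_le_exp x
    _ = _ := by ring

/-! ### Poisson summation for autocorrelations -/

section Autocorrelation

lemma summable_int_inv_one_add_sq : Summable fun k : ℤ => (1 + (k : ℝ) ^ 2)⁻¹ := by
  have h := ((Real.summable_one_div_int_add_rpow (1 / 2) 2).2 one_lt_two).mul_left 2
  refine h.of_nonneg_of_le (fun k => by positivity) fun k => ?_
  have h1 : (k : ℝ) + 1 / 2 ≠ 0 := by
    intro h
    have : (2 * k + 1 : ℝ) = 0 := by linarith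
    norm_cast at this
    omega
  have h2 : |(k : ℝ) + 1 / 2| ^ (2 : ℝ) = ((k : ℝ) + 1 / 2) ^ 2 := by
    rw [Real.rpow_two, sq_abs]
  rw [h2, ← div_eq_mul_one_div, inv_eq_one_div, div_le_div_iff₀ (by positivity) (by positivity)]
  nlinarith [sq_nonneg ((k : ℝ) - 1 / 2)]

lemma SchwartzMap.summable_norm_sq_int (F : 𝓢(ℝ, ℂ)) : Summable fun k : ℤ => ‖F k‖ ^ 2 := by
  obtain ⟨C, hC⟩ := F.exists_norm_le_inv_one_add_sq
  refine (summable_int_inv_one_add_sq.mul_left (C ^ 2)).of_nonneg_of_le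
    (fun k => by positivity) fun k => ?_
  have h1 : (1 + (k : ℝ) ^ 2)⁻¹ ≤ 1 := inv_le_one_of_one_le₀ (by nlinarith [sq_nonneg (k : ℝ)])
  calc ‖F k‖ ^ 2 ≤ (C * (1 + (k : ℝ) ^ 2)⁻¹) ^ 2 := pow_le_pow_left₀ (norm_nonneg _) (hC k) 2
    _ = C ^ 2 * ((1 + (k : ℝ) ^ 2)⁻¹ * (1 + (k : ℝ) ^ 2)⁻¹) := by ring
    _ ≤ C ^ 2 * ((1 + (k : ℝ) ^ 2)⁻¹ * 1) := by gcongr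
    _ = _ := by ring

/-- The function `t ↦ conj (F (-t))`. -/
noncomputable def SchwartzMap.reflectConj (F : 𝓢(ℝ, ℂ)) : 𝓢(ℝ, ℂ) :=
  SchwartzMap.postcompCLM (Complex.conjCLE : ℂ →L[ℝ] ℂ)
    (SchwartzMap.compCLMOfContinuousLinearEquiv ℝ (ContinuousLinearEquiv.neg ℝ) F)

lemma SchwartzMap.reflectConj_apply (F : 𝓢(ℝ, ℂ)) (t : ℝ) :
    F.reflectConj t = conj (F (-t)) := by
  simp [SchwartzMap.reflectConj]

lemma SchwartzMap.fourier_reflectConj (F : 𝓢(ℝ, ℂ)) (x : ℝ) :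
    𝓕 F.reflectConj x = conj (𝓕 F x) := by
  rw [SchwartzMap.fourier_coe, SchwartzMap.fourier_coe, fourier_apply_eq_integral,
    fourier_apply_eq_integral, ← integral_conj, ← integral_neg_eq_self]
  refine integral_congr_ae (ae_of_all _ fun t => ?_)
  simp only [SchwartzMap.reflectConj_apply, neg_neg, map_mul, ← Complex.exp_conj, Complex.conj_I,
    Complex.conj_ofReal]
  congr 2
  push_cast
  ring

/-- The Poisson summation formula for the autocorrelation of a Schwartz function. -/
theorem SchwartzMap.tsum_norm_sq_fourier (F : 𝓢(ℝ, ℂ)) :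
    ((∑' k : ℤ, ‖𝓕 F k‖ ^ 2 : ℝ) : ℂ) = ∑' n : ℤ, ∫ t, F t * conj (F (t - n)) := by
  -- The formula is applied to the convolution of F with t ↦ conj(F(-t)), whose transform is |𝓕 F|².
  have h := SchwartzMap.tsum_eq_tsum_fourier
    (SchwartzMap.convolution (ContinuousLinearMap.mul ℂ ℂ) F F.reflectConj) 0
  rw [Complex.ofReal_tsum]
  convert h.symm using 1
  · refine tsum_congr fun k => ?_
    rw [SchwartzMap.fourier_convolution, SchwartzMap.pairing_apply_apply,
      SchwartzMap.fourier_reflectConj]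
    simp [Complex.mul_conj']
  · refine tsum_congr fun n => ?_
    rw [SchwartzMap.convolution_apply, convolution_def, zero_add]
    simp only [ContinuousLinearMap.mul_apply', SchwartzMap.reflectConj_apply, neg_sub]

end Autocorrelation

/-! ### Parseval's identity for Meyer wavelets -/

/-- The Fourier transform of a Meyer wavelet. -/
structure IsMeyerBand (β : ℝ → ℂ) : Prop where
  contDiff : ContDiff ℝ ∞ β
  eq_zero : ∀ x, |x| ∉ Set.Ioo (1 / 3 : ℝ) (4 / 3) → β x = 0
  sum_dilates : ∀ x, x ≠ 0 → HasSum (fun j : ℤ => ‖β ((2 : ℝ) ^ j * x)‖ ^ 2) 1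
  cancel : ∀ x, conj (β x) * β (x - 1) + conj (β (2 * x)) * β (2 * x - 2) = 0
  integral_norm_sq : ∫ x, ‖β x‖ ^ 2 = 1

/-- A smooth function supported in an annulus `r ≤ |x| ≤ R`. -/
structure IsAnnular (F : ℝ → ℂ) (r R : ℝ) : Prop where
  contDiff : ContDiff ℝ ∞ F
  pos : 0 < r
  eq_zero : ∀ x, |x| ∉ Set.Icc r R → F x = 0

lemma IsAnnular.hasCompactSupport {F : ℝ → ℂ} {r R : ℝ} (h : IsAnnular F r R) :
    HasCompactSupport F :=
  HasCompactSupport.intro (isCompact_Icc (a := -R) (b := R)) fun x hx =>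
    h.eq_zero x fun h' => hx (abs_le.1 h'.2)

/-- The Fourier transform of `ψ_{j,k}` if `β` is the Fourier transform of `ψ`. -/
noncomputable def waveletFourier (β : ℝ → ℂ) (j k : ℤ) (x : ℝ) : ℂ :=
  (((2 : ℝ) ^ (-(j : ℝ) / 2) : ℝ) : ℂ) *
    (Complex.exp ((-2 * Real.pi * k * ((2 : ℝ) ^ (-j) * x) : ℝ) * Complex.I) *
      β ((2 : ℝ) ^ (-j) * x))

namespace IsMeyerBand

variable {β : ℝ → ℂ} (hβ : IsMeyerBand β)
include hβ

lemma hasCompactSupport : HasCompactSupport β :=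
  HasCompactSupport.intro (isCompact_Icc (a := -(4 / 3 : ℝ)) (b := 4 / 3)) fun x hx =>
    hβ.eq_zero x fun h' => hx (abs_le.1 h'.2.le)

lemma cancel' (x : ℝ) : conj (β x) * β (x + 1) + conj (β (2 * x)) * β (2 * x + 2) = 0 := by
  have h := congrArg conj (hβ.cancel (x + 1))
  simp only [map_add, map_mul, Complex.conj_conj, map_zero] at h
  rw [show x + 1 - 1 = x by ring, show 2 * (x + 1) - 2 = 2 * x by ring,
    show 2 * (x + 1) = 2 * x + 2 by ring] at h
  rw [← h]
  ring

lemma conj_mul_shift_eq_zero {n : ℤ} (hn : n ∉ Finset.Icc (-2 : ℤ) 2) (x : ℝ) :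
    conj (β x) * β (x - n) = 0 := by
  by_contra h
  have h1 : |x| ∈ Set.Ioo (1 / 3 : ℝ) (4 / 3) := by
    by_contra h'; exact h (by rw [hβ.eq_zero x h', map_zero, zero_mul])
  have h2 : |x - n| ∈ Set.Ioo (1 / 3 : ℝ) (4 / 3) := by
    by_contra h'; exact h (by rw [hβ.eq_zero _ h', mul_zero])
  have h3 := abs_lt.1 h1.2
  have h4 := abs_lt.1 h2.2
  apply hn
  have h5 : (n : ℝ) < 3 := by linarith
  have h6 : (-3 : ℝ) < n := by linarith
  have h5 : n < 3 := by exact_mod_cast h5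
  have h6 : -3 < n := by exact_mod_cast h6
  simp only [Finset.mem_Icc]
  omega

section Scale

variable {F : ℝ → ℂ} {r R : ℝ} (hF : IsAnnular F r R)
include hF

/-- The product of `conj β` and a dilate of `F`. -/
noncomputable def localize (j : ℤ) : 𝓢(ℝ, ℂ) :=
  HasCompactSupport.toSchwartzMap (f := fun x => conj (β x) * F ((2 : ℝ) ^ j * x))
    ((hβ.hasCompactSupport.comp_left (map_zero _)).mul_right)
    ((Complex.conjCLE.contDiff.comp hβ.contDiff).mul
      (hF.contDiff.comp (contDiff_const.mul contDiff_id)))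

lemma localize_apply (j : ℤ) (x : ℝ) :
    localize hβ hF j x = conj (β x) * F ((2 : ℝ) ^ j * x) := rfl

lemma exists_scale_bound : ∃ S : Finset ℤ, ∀ j ∉ S, ∀ x, β x * F ((2 : ℝ) ^ j * x) = 0 := by
  -- If both factors are nonzero, 1/3 < |x| < 4/3 and r ≤ 2^j |x| ≤ R, so 3r/4 < 2^j < 3R. The
  -- maximum with 1 only ensures positivity.
  obtain ⟨a, ha⟩ := exists_mem_Ico_zpow (x := r * (3 / 4)) (y := 2)
    (mul_pos hF.pos (by norm_num)) one_lt_two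
  obtain ⟨b, hb⟩ := exists_mem_Ico_zpow (x := max (R * 3) 1) (y := 2)
    (lt_max_of_lt_right one_pos) one_lt_two
  refine ⟨Finset.Icc a (b + 1), fun j hj x => ?_⟩
  by_contra h
  have h1 : |x| ∈ Set.Ioo (1 / 3 : ℝ) (4 / 3) := by
    by_contra h'; exact h (by rw [hβ.eq_zero x h', zero_mul])
  have h2 : |(2 : ℝ) ^ j * x| ∈ Set.Icc r R := by
    by_contra h'; exact h (by rw [hF.eq_zero _ h', mul_zero])
  have hp : (0 : ℝ) < 2 ^ j := by positivity
  rw [abs_mul, abs_of_pos hp] at h2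
  have h3 : (2 : ℝ) ^ a < 2 ^ j := by
    refine ha.1.trans_lt ?_
    nlinarith [h2.1, h1.2]
  have h4 : (2 : ℝ) ^ j < 2 ^ (b + 1) := by
    refine lt_of_lt_of_le ?_ ((le_max_left _ _).trans hb.2.le)
    nlinarith [h2.2, h1.1]
  rw [zpow_lt_zpow_iff_right₀ one_lt_two] at h3 h4
  exact hj (Finset.mem_Icc.2 ⟨h3.le, h4.le⟩)

/-- The autocorrelation of the localization of `F` at scale `j`. -/
noncomputable def correlation (j n : ℤ) : ℂ :=
  (2 : ℂ) ^ j * ∫ t, localize hβ hF j t * conj (localize hβ hF j (t - n))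

lemma correlation_eq_zero_of_shift (j : ℤ) {n : ℤ} (hn : n ∉ Finset.Icc (-2 : ℤ) 2) :
    correlation hβ hF j n = 0 := by
  unfold correlation
  rw [integral_eq_zero_of_ae, mul_zero]
  refine ae_of_all _ fun t => ?_
  simp only [localize_apply, map_mul, Complex.conj_conj, Pi.zero_apply]
  have := hβ.conj_mul_shift_eq_zero hn t
  linear_combination F (2 ^ j * t) * conj (F (2 ^ j * (t - n))) * this

/-- The substitution t ↦ 2t turns the shift 2n at scale j into the shift n at scale j + 1 with the
same values of F, so the pointwise cancellation in β can be integrated against them. -/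
lemma correlation_succ_add (j : ℤ) (n : ℤ)
    (hn : ∀ x, conj (β x) * β (x - n) + conj (β (2 * x)) * β (2 * x - 2 * n) = 0) :
    correlation hβ hF (j + 1) n + correlation hβ hF j (2 * n) = 0 := by
  unfold correlation
  have h1 : ∫ t, localize hβ hF j t * conj (localize hβ hF j (t - (2 * n : ℤ))) =
      2 * ∫ t, localize hβ hF j (2 * t) * conj (localize hβ hF j (2 * t - (2 * n : ℤ))) := by
    have := Measure.integral_comp_mul_left
      (fun t => localize hβ hF j t * conj (localize hβ hF j (t - (2 * n : ℤ)))) 2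
    rw [this, abs_of_pos (by norm_num), Complex.real_smul, ← mul_assoc]
    norm_num
  have h2 : ∀ t, localize hβ hF j (2 * t) * conj (localize hβ hF j (2 * t - (2 * n : ℤ))) =
      -(localize hβ hF (j + 1) t * conj (localize hβ hF (j + 1) (t - n))) := by
    intro t
    simp only [localize_apply, map_mul, Complex.conj_conj]
    rw [zpow_add_one₀ (two_ne_zero' ℝ)]
    push_cast
    rw [show (2 : ℝ) ^ j * 2 * t = 2 ^ j * (2 * t) by ring,
      show (2 : ℝ) ^ j * 2 * (t - n) = 2 ^ j * (2 * t - 2 * n) by ring]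
    linear_combination F (2 ^ j * (2 * t)) * conj (F (2 ^ j * (2 * t - 2 * n))) * hn t
  rw [h1, integral_congr_ae (ae_of_all _ h2), integral_neg, zpow_add_one₀ (two_ne_zero' ℂ)]
  ring

lemma correlation_zero (j : ℤ) :
    correlation hβ hF j 0 =
      ((∫ x, ‖β ((2 : ℝ) ^ (-j) * x)‖ ^ 2 * ‖F x‖ ^ 2 : ℝ) : ℂ) := by
  unfold correlation
  have h := Measure.integral_comp_mul_left
    (fun x => ‖β ((2 : ℝ) ^ (-j) * x)‖ ^ 2 * ‖F x‖ ^ 2) ((2 : ℝ) ^ j)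
  have hp : (0 : ℝ) < 2 ^ j := by positivity
  have h1 : ∀ t, localize hβ hF j t * conj (localize hβ hF j (t - (0 : ℤ))) =
      ((‖β ((2 : ℝ) ^ (-j) * (2 ^ j * t))‖ ^ 2 * ‖F (2 ^ j * t)‖ ^ 2 : ℝ) : ℂ) := by
    intro t
    rw [Int.cast_zero, sub_zero, Complex.mul_conj', localize_apply, norm_mul, RCLike.norm_conj,
      ← mul_assoc, ← zpow_add₀ two_ne_zero, neg_add_cancel, zpow_zero, one_mul]
    push_cast
    ring
  rw [integral_congr_ae (ae_of_all _ h1), integral_complex_ofReal, h, abs_of_pos (by positivity),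
    smul_eq_mul]
  push_cast
  rw [← mul_assoc, mul_inv_cancel₀ (zpow_ne_zero _ two_ne_zero), one_mul]

lemma correlation_eq_zero_of_scale : ∃ S : Finset ℤ, ∀ j ∉ S, ∀ n, correlation hβ hF j n = 0 := by
  obtain ⟨S, hS⟩ := exists_scale_bound hβ hF
  refine ⟨S, fun j hj n => ?_⟩
  unfold correlation
  rw [integral_eq_zero_of_ae, mul_zero]
  refine ae_of_all _ fun t => ?_
  simp only [localize_apply, Pi.zero_apply]
  have h := hS j hj t
  rcases mul_eq_zero.1 h with h | h <;> simp [h]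

lemma hasSum_correlation_zero :
    HasSum (fun j : ℤ => correlation hβ hF j 0) ((∫ x, ‖F x‖ ^ 2 : ℝ) : ℂ) := by
  obtain ⟨S, hS⟩ := exists_scale_bound hβ hF
  have h0 : ∀ j ∉ S, ∀ x, ‖β ((2 : ℝ) ^ (-j) * x)‖ ^ 2 * ‖F x‖ ^ 2 = 0 := by
    intro j hj x
    have h := hS j hj ((2 : ℝ) ^ (-j) * x)
    rw [← mul_assoc, ← zpow_add₀ two_ne_zero, add_neg_cancel, zpow_zero, one_mul] at h
    rw [← mul_pow, ← norm_mul, h]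
    simp
  have hint : ∀ j : ℤ, Integrable fun x => ‖β ((2 : ℝ) ^ (-j) * x)‖ ^ 2 * ‖F x‖ ^ 2 := by
    intro j
    have hβc := hβ.contDiff.continuous
    have hFc := hF.contDiff.continuous
    refine Continuous.integrable_of_hasCompactSupport (by fun_prop) ?_
    exact (hF.hasCompactSupport.comp_left (g := fun z : ℂ => ‖z‖ ^ 2) (by simp)).mul_left
  have hsum : ∑ j ∈ S, correlation hβ hF j 0 = ((∫ x, ‖F x‖ ^ 2 : ℝ) : ℂ) := by
    simp only [correlation_zero]
    rw [← Complex.ofReal_sum, ← integral_finsetSum _ fun j _ => hint j]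
    congr 1
    refine integral_congr_ae (ae_of_all _ fun x => ?_)
    simp only
    rcases eq_or_ne x 0 with rfl | hx
    · have : F 0 = 0 := hF.eq_zero 0 fun h => by
        rw [abs_zero] at h
        exact absurd h.1 (not_le.2 hF.pos)
      simp [this]
    · have h1 := (((Equiv.neg ℤ).hasSum_iff).2 (hβ.sum_dilates x hx)).mul_right (‖F x‖ ^ 2)
      rw [one_mul] at h1
      exact (hasSum_sum_of_ne_finset_zero fun j hj => h0 j hj x).unique h1
  rw [← hsum]
  refine hasSum_sum_of_ne_finset_zero fun j hj => ?_
  rw [correlation_zero, integral_congr_ae (ae_of_all _ (h0 j hj))]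
  simp

/-- The sums of the autocorrelations over all scales and shifts telescope. -/
lemma hasSum_sum_correlation :
    HasSum (fun j : ℤ => ∑ n ∈ Finset.Icc (-2 : ℤ) 2, correlation hβ hF j n)
      ((∫ x, ‖F x‖ ^ 2 : ℝ) : ℂ) := by
  obtain ⟨S, hS⟩ := correlation_eq_zero_of_scale hβ hF
  -- Only finitely many scales contribute, so the sum over j is invariant under j ↦ j + 1.
  have htel : ∀ n : ℤ, HasSum (fun j : ℤ => correlation hβ hF j n - correlation hβ hF (j + 1) n)
      0 := by
    intro n
    have h1 : HasSum (fun j : ℤ => correlation hβ hF j n) (∑ j ∈ S, correlation hβ hF j n) :=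
      hasSum_sum_of_ne_finset_zero fun j hj => hS j hj n
    have h2 := ((Equiv.addRight (1 : ℤ)).hasSum_iff).2 h1
    simpa using h1.sub h2
  have h1 : ∀ j, correlation hβ hF j 2 = -correlation hβ hF (j + 1) 1 := fun j => by
    have := correlation_succ_add hβ hF j 1 (by simpa using hβ.cancel)
    rw [mul_one] at this
    linear_combination this
  have h2 : ∀ j, correlation hβ hF j (-2) = -correlation hβ hF (j + 1) (-1) := fun j => by
    have := correlation_succ_add hβ hF j (-1) (by simpa using hβ.cancel')
    rw [mul_neg, mul_one] at this
    linear_combination this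
  -- At each scale the shifts ±2 are replaced by minus the shifts ±1 one scale up, leaving the shift
  -- 0 and two telescoping differences.
  have h := ((hasSum_correlation_zero hβ hF).add (htel 1)).add (htel (-1))
  rw [add_zero, add_zero] at h
  convert h using 2 with j
  have : Finset.Icc (-2 : ℤ) 2 = {-2, -1, 0, 1, 2} := by decide
  rw [this]
  simp only [Finset.mem_insert, Finset.mem_singleton, Finset.sum_insert, Finset.sum_singleton,
    not_false_eq_true, reduceCtorEq, neg_inj, OfNat.ofNat_ne_one, or_self, Int.reduceNeg,
    Int.reduceEq]
  rw [h1, h2]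
  ring

/-- The coefficients of `F` are the Fourier coefficients of its localizations. -/
lemma norm_sq_coefficient (j k : ℤ) :
    ‖∫ x, conj (waveletFourier β j k x) * F x‖ ^ 2 =
      (2 : ℝ) ^ j * ‖𝓕 (localize hβ hF j) ((-k : ℤ) : ℝ)‖ ^ 2 := by
  have hp : (0 : ℝ) < 2 ^ j := by positivity
  have h := Measure.integral_comp_mul_left
    (fun x => conj (waveletFourier β j k x) * F x) ((2 : ℝ) ^ j)
  rw [abs_of_pos (by positivity), Complex.real_smul] at h
  -- Rescaling brings out 2^j; squared and multiplied by the squared normalization 2^(-j), it leaves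
  -- 2^j.
  have h1 : ∫ x, conj (waveletFourier β j k x) * F x =
      (2 : ℂ) ^ j * ∫ x, conj (waveletFourier β j k (2 ^ j * x)) * F (2 ^ j * x) := by
    rw [h, ← mul_assoc]
    push_cast
    rw [mul_inv_cancel₀ (zpow_ne_zero _ two_ne_zero), one_mul]
  have h2 : ∀ x, conj (waveletFourier β j k (2 ^ j * x)) * F (2 ^ j * x) =
      (((2 : ℝ) ^ (-(j : ℝ) / 2) : ℝ) : ℂ) *
        (Complex.exp ((-2 * Real.pi * ((-k : ℤ) : ℝ) * x : ℝ) * Complex.I) *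
          localize hβ hF j x) := by
    intro x
    rw [waveletFourier, ← mul_assoc ((2 : ℝ) ^ (-j)), ← zpow_add₀ two_ne_zero, neg_add_cancel,
      zpow_zero, one_mul, localize_apply]
    simp only [map_mul, Complex.conj_ofReal, ← Complex.exp_conj, Complex.conj_I]
    rw [mul_assoc, mul_assoc]
    congr 3
    push_cast
    ring
  rw [h1, integral_congr_ae (ae_of_all _ h2), integral_const_mul, SchwartzMap.fourier_coe,
    fourier_apply_eq_integral, norm_mul, norm_mul, mul_pow, mul_pow, ← mul_assoc]
  congr 1
  rw [norm_zpow, Complex.norm_real, Complex.norm_ofNat, Real.norm_eq_abs, sq_abs,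
    ← Real.rpow_natCast (2 ^ (-(j : ℝ) / 2)), ← Real.rpow_mul two_pos.le,
    show -(j : ℝ) / 2 * (2 : ℕ) = ((-j : ℤ) : ℝ) by push_cast; ring, Real.rpow_intCast,
    ← zpow_natCast, ← zpow_mul, ← zpow_add₀ two_ne_zero]
  congr 1
  push_cast
  ring

/-- Parseval's identity for functions whose Fourier transform is annular. -/
theorem hasSum_norm_sq_coefficient :
    HasSum (fun p : ℤ × ℤ => ‖∫ x, conj (waveletFourier β p.1 p.2 x) * F x‖ ^ 2)
      (∫ x, ‖F x‖ ^ 2) := by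
  have hs : ∀ j : ℤ, Summable fun k : ℤ => ‖𝓕 (localize hβ hF j) ((-k : ℤ) : ℝ)‖ ^ 2 := fun j =>
    ((Equiv.neg ℤ).summable_iff (f := fun k : ℤ => ‖𝓕 (localize hβ hF j) (k : ℝ)‖ ^ 2)).2
      (𝓕 (localize hβ hF j)).summable_norm_sq_int
  have ht : ∀ j : ℤ, ((∑' k : ℤ, ‖∫ x, conj (waveletFourier β j k x) * F x‖ ^ 2 : ℝ) : ℂ) =
      ∑ n ∈ Finset.Icc (-2 : ℤ) 2, correlation hβ hF j n := by
    intro j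
    have e := (Equiv.neg ℤ).tsum_eq (fun k : ℤ => ‖𝓕 (localize hβ hF j) (k : ℝ)‖ ^ 2)
    simp only [Equiv.neg_apply] at e
    simp only [norm_sq_coefficient hβ hF]
    rw [tsum_mul_left, e]
    rw [Complex.ofReal_mul, SchwartzMap.tsum_norm_sq_fourier, ← tsum_mul_left]
    push_cast
    exact tsum_eq_sum fun n hn => correlation_eq_zero_of_shift hβ hF j hn
  have hj : HasSum (fun j : ℤ => ∑' k : ℤ, ‖∫ x, conj (waveletFourier β j k x) * F x‖ ^ 2)
      (∫ x, ‖F x‖ ^ 2) := by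
    rw [← Complex.hasSum_ofReal]
    simp only [ht]
    exact hasSum_sum_correlation hβ hF
  have hsum : Summable fun p : ℤ × ℤ => ‖∫ x, conj (waveletFourier β p.1 p.2 x) * F x‖ ^ 2 := by
    refine (summable_prod_of_nonneg fun p => by positivity).2 ⟨fun j => ?_, hj.summable⟩
    simp only [norm_sq_coefficient hβ hF]
    exact (hs j).mul_left _
  rw [hsum.hasSum_iff, hsum.tsum_prod]
  exact hj.tsum_eq

end Scale

end IsMeyerBand

/-! ### Angle functions give Meyer bands -/

namespace IsMeyerAngle

variable {Φ : ℝ → ℝ} (h : IsMeyerAngle Φ)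

lemma norm_meyerFourier (Φ : ℝ → ℝ) (x : ℝ) :
    ‖meyerFourier Φ x‖ = |Real.sin (Real.pi / 2 * Φ x)| := by
  rw [meyerFourier, norm_mul, Complex.norm_exp_ofReal_mul_I, one_mul, Complex.norm_real,
    Real.norm_eq_abs]

lemma norm_sq_meyerFourier (Φ : ℝ → ℝ) (x : ℝ) :
    ‖meyerFourier Φ x‖ ^ 2 = Real.sin (Real.pi / 2 * Φ x) ^ 2 := by
  rw [norm_meyerFourier, sq_abs]

include h

lemma sin_eq_zero {x : ℝ} (hx : |x| ∉ Set.Ioo (1 / 3 : ℝ) (4 / 3)) :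
    Real.sin (Real.pi / 2 * Φ x) = 0 := by
  rw [h.eq_zero x hx, mul_zero, Real.sin_zero]

lemma sin_two_mul_eq_cos {x : ℝ} (hx : x ∈ Set.Icc (1 / 3 : ℝ) (2 / 3)) :
    Real.sin (Real.pi / 2 * Φ (2 * x)) = Real.cos (Real.pi / 2 * Φ x) := by
  rw [eq_sub_of_add_eq' (h.add_two_mul x hx), mul_sub, mul_one, Real.sin_pi_div_two_sub]

lemma sin_reflect_eq_cos {x : ℝ} (hx : x ∈ Set.Icc (1 / 3 : ℝ) (2 / 3)) :
    Real.sin (Real.pi / 2 * Φ (1 - x)) = Real.cos (Real.pi / 2 * Φ x) := by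
  rw [eq_sub_of_add_eq' (h.add_reflect x hx), mul_sub, mul_one, Real.sin_pi_div_two_sub]

lemma sin_sq_add_two_mul {x : ℝ} (hx : x ∈ Set.Icc (1 / 3 : ℝ) (2 / 3)) :
    Real.sin (Real.pi / 2 * Φ x) ^ 2 + Real.sin (Real.pi / 2 * Φ (2 * x)) ^ 2 = 1 := by
  rw [h.sin_two_mul_eq_cos hx, Real.sin_sq_add_cos_sq]

/-- On [1/3, 2/3] the angle identities express both sides through sines and cosines at x and 1 - x.
Elsewhere each product vanishes because the supports do not meet. -/
lemma sin_mul_sin_shift (x : ℝ) :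
    Real.sin (Real.pi / 2 * Φ x) * Real.sin (Real.pi / 2 * Φ (x - 1)) =
      Real.sin (Real.pi / 2 * Φ (2 * x)) * Real.sin (Real.pi / 2 * Φ (2 * x - 2)) := by
  by_cases hx : x ∈ Set.Icc (1 / 3 : ℝ) (2 / 3)
  · have hx' : 1 - x ∈ Set.Icc (1 / 3 : ℝ) (2 / 3) := ⟨by linarith [hx.2], by linarith [hx.1]⟩
    have e1 : Φ (x - 1) = Φ (1 - x) := by rw [← h.even, neg_sub]
    have e2 : Φ (2 * x - 2) = Φ (2 * (1 - x)) := by rw [← h.even]; congr 1; ring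
    have e3 := h.sin_reflect_eq_cos hx'
    rw [sub_sub_cancel] at e3
    rw [e1, e2, h.sin_reflect_eq_cos hx, h.sin_two_mul_eq_cos hx, h.sin_two_mul_eq_cos hx', ← e3]
    ring
  · have hx' : x < 1 / 3 ∨ 2 / 3 < x := by
      by_contra! h'; exact hx ⟨h'.1, h'.2⟩
    have hl : Real.sin (Real.pi / 2 * Φ x) * Real.sin (Real.pi / 2 * Φ (x - 1)) = 0 := by
      by_contra hne
      have h1 : |x| ∈ Set.Ioo (1 / 3 : ℝ) (4 / 3) := by
        by_contra h'; exact hne (by rw [h.sin_eq_zero h', zero_mul])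
      have h2 : |x - 1| ∈ Set.Ioo (1 / 3 : ℝ) (4 / 3) := by
        by_contra h'; exact hne (by rw [h.sin_eq_zero h', mul_zero])
      have h3 := abs_lt.1 h1.2
      have h4 := abs_lt.1 h2.2
      have h5 := lt_abs.1 h1.1
      have h6 := lt_abs.1 h2.1
      rcases hx' with hx' | hx' <;> rcases h5 with h5 | h5 <;> rcases h6 with h6 | h6 <;> linarith
    have hr : Real.sin (Real.pi / 2 * Φ (2 * x)) * Real.sin (Real.pi / 2 * Φ (2 * x - 2)) = 0 := by
      by_contra hne
      have h1 : |2 * x| ∈ Set.Ioo (1 / 3 : ℝ) (4 / 3) := by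
        by_contra h'; exact hne (by rw [h.sin_eq_zero h', zero_mul])
      have h2 : |2 * x - 2| ∈ Set.Ioo (1 / 3 : ℝ) (4 / 3) := by
        by_contra h'; exact hne (by rw [h.sin_eq_zero h', mul_zero])
      have h3 := abs_lt.1 h1.2
      have h4 := abs_lt.1 h2.2
      rcases hx' with hx' | hx' <;> linarith
    rw [hl, hr]

lemma sin_sq_abs (x : ℝ) : Real.sin (Real.pi / 2 * Φ |x|) = Real.sin (Real.pi / 2 * Φ x) := by
  rcases abs_choice x with hx | hx
  · rw [hx]
  · rw [hx, h.even]

lemma hasSum_sin_sq {x : ℝ} (hx : x ≠ 0) :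
    HasSum (fun j : ℤ => Real.sin (Real.pi / 2 * Φ ((2 : ℝ) ^ j * x)) ^ 2) 1 := by
  -- This n places y = 2^(-n) |x| in [1/3, 2/3); then only y and 2y among the dyadic dilates of y
  -- can lie in the open band.
  obtain ⟨n, hn⟩ := exists_mem_Ico_zpow (x := |x| * 3) (y := (2 : ℝ))
    (by positivity) one_lt_two
  have hp : (0 : ℝ) < 2 ^ n := by positivity
  rw [Set.mem_Ico, zpow_add_one₀ two_ne_zero] at hn
  set y := (2 : ℝ) ^ (-n) * |x| with hy
  have hxy : |x| = 2 ^ n * y := by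
    rw [hy, ← mul_assoc, ← zpow_add₀ two_ne_zero, add_neg_cancel, zpow_zero, one_mul]
  have hymem : y ∈ Set.Ico (1 / 3 : ℝ) (2 / 3) := by
    rw [hxy] at hn
    constructor <;> nlinarith [hn.1, hn.2]
  have hval : ∀ j : ℤ, Real.sin (Real.pi / 2 * Φ ((2 : ℝ) ^ j * x)) =
      Real.sin (Real.pi / 2 * Φ ((2 : ℝ) ^ (j + n) * y)) := by
    intro j
    rw [← h.sin_sq_abs, abs_mul, abs_of_pos (show (0 : ℝ) < 2 ^ j by positivity), hxy, ← mul_assoc,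
      ← zpow_add₀ two_ne_zero]
  have hs : HasSum (fun i : ℤ => Real.sin (Real.pi / 2 * Φ ((2 : ℝ) ^ i * y)) ^ 2) 1 := by
    have h01 : ∑ i ∈ ({0, 1} : Finset ℤ), Real.sin (Real.pi / 2 * Φ ((2 : ℝ) ^ i * y)) ^ 2 = 1 := by
      rw [Finset.sum_pair zero_ne_one, zpow_zero, zpow_one, one_mul]
      exact h.sin_sq_add_two_mul ⟨hymem.1, hymem.2.le⟩
    rw [← h01]
    refine hasSum_sum_of_ne_finset_zero fun i hi => ?_
    rw [h.sin_eq_zero, zero_pow two_ne_zero]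
    have hip : (0 : ℝ) < 2 ^ i := by positivity
    have hy0 : 0 < y := by linarith [hymem.1]
    rw [abs_of_pos (mul_pos hip hy0)]
    intro hmem
    have h1 : i < 2 := by
      by_contra! h'
      have : (2 : ℝ) ^ (2 : ℤ) ≤ 2 ^ i := zpow_le_zpow_right₀ one_le_two h'
      norm_num at this
      nlinarith [hmem.2, hymem.1]
    have h2 : -1 < i := by
      by_contra! h'
      have : (2 : ℝ) ^ i ≤ 2 ^ (-1 : ℤ) := zpow_le_zpow_right₀ one_le_two h'
      norm_num at this
      nlinarith [hmem.1, hymem.2]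
    apply hi
    simp only [Finset.mem_insert, Finset.mem_singleton]
    omega
  have := ((Equiv.addRight n).hasSum_iff).2 hs
  simpa only [hval, Function.comp_def, Equiv.coe_addRight] using this

lemma integral_sin_sq : ∫ x, Real.sin (Real.pi / 2 * Φ x) ^ 2 = 1 := by
  set q : ℝ → ℝ := fun x => Real.sin (Real.pi / 2 * Φ x) ^ 2 with hq
  have hΦc := h.contDiff.continuous
  have hqc : Continuous q := by fun_prop
  have hint : ∀ a b, IntervalIntegrable q volume a b := fun a b => hqc.intervalIntegrable a b
  have h1 : ∫ x, q x = 2 * ∫ x in Set.Ioi 0, q x := by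
    rw [← integral_comp_abs]
    simp only [hq, h.sin_sq_abs]
  have h2 : ∫ x in Set.Ioi 0, q x = ∫ x in (1 / 3 : ℝ)..(4 / 3), q x := by
    rw [intervalIntegral.integral_of_le (by norm_num)]
    refine setIntegral_eq_of_subset_of_forall_sdiff_eq_zero measurableSet_Ioi ?_ ?_
    · exact fun x hx => lt_trans (by norm_num) hx.1
    · intro x hx
      simp only [hq]
      rw [h.sin_eq_zero, zero_pow two_ne_zero]
      rw [abs_of_pos hx.1]
      exact fun hm => hx.2 ⟨hm.1, hm.2.le⟩
  have h3 := intervalIntegral.integral_add_adjacent_intervals (hint (1 / 3) (2 / 3))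
    (hint (2 / 3) (4 / 3))
  have h4 : ∫ x in (2 / 3 : ℝ)..(4 / 3), q x = 2 * ∫ x in (1 / 3 : ℝ)..(2 / 3), q (2 * x) := by
    rw [intervalIntegral.mul_integral_comp_mul_left]
    norm_num
  have h5 : ∫ x in (1 / 3 : ℝ)..(2 / 3), q (2 * x) = 1 / 3 - ∫ x in (1 / 3 : ℝ)..(2 / 3), q x := by
    have : ∫ x in (1 / 3 : ℝ)..(2 / 3), q (2 * x) = ∫ x in (1 / 3 : ℝ)..(2 / 3), (1 - q x) := by
      refine intervalIntegral.integral_congr fun x hx => ?_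
      rw [Set.uIcc_of_le (by norm_num)] at hx
      simp only [hq]
      linarith [h.sin_sq_add_two_mul hx]
    rw [this, intervalIntegral.integral_sub (by simp) (hint _ _)]
    norm_num
  -- Reflection about 1/2 exchanges sin² and cos², so the integral I over [1/3, 2/3] is 1/6. The
  -- outer part [2/3, 4/3] contributes 2(1/3 - I) = 1/3, and the half-line total is 1/2.
  have h6 : ∫ x in (1 / 3 : ℝ)..(2 / 3), q x = 1 / 3 - ∫ x in (1 / 3 : ℝ)..(2 / 3), q x := by
    have e1 := intervalIntegral.integral_comp_sub_left q 1 (a := 1 / 3) (b := 2 / 3)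
    have e2 : ∫ x in (1 / 3 : ℝ)..(2 / 3), q (1 - x) = ∫ x in (1 / 3 : ℝ)..(2 / 3), (1 - q x) := by
      refine intervalIntegral.integral_congr fun x hx => ?_
      rw [Set.uIcc_of_le (by norm_num)] at hx
      simp only [hq]
      rw [h.sin_reflect_eq_cos hx]
      linarith [Real.sin_sq_add_cos_sq (Real.pi / 2 * Φ x)]
    rw [intervalIntegral.integral_sub (by simp) (hint _ _)] at e2
    norm_num at e1 e2 ⊢
    linarith
  rw [h1, h2]
  linarith

theorem isMeyerBand : IsMeyerBand (meyerFourier Φ) where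
  contDiff := by
    have h1 : ContDiff ℝ ∞ fun x : ℝ => Complex.exp ((-Real.pi * x : ℝ) * Complex.I) := by
      have : ContDiff ℝ ∞ fun x : ℝ => ((-Real.pi * x : ℝ) : ℂ) :=
        Complex.ofRealCLM.contDiff.comp (contDiff_const.mul contDiff_id)
      exact (this.mul contDiff_const).cexp
    have h2 : ContDiff ℝ ∞ fun x : ℝ => ((Real.sin (Real.pi / 2 * Φ x) : ℝ) : ℂ) :=
      Complex.ofRealCLM.contDiff.comp (Real.contDiff_sin.comp (contDiff_const.mul h.contDiff))
    exact h1.mul h2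
  eq_zero x hx := by rw [meyerFourier, h.sin_eq_zero hx, Complex.ofReal_zero, mul_zero]
  sum_dilates x hx := by
    simp only [norm_sq_meyerFourier]
    exact h.hasSum_sin_sq hx
  cancel x := by
    have e : ∀ a b : ℝ, conj (meyerFourier Φ a) * meyerFourier Φ b =
        Complex.exp ((Real.pi * (a - b) : ℝ) * Complex.I) *
          ((Real.sin (Real.pi / 2 * Φ a) * Real.sin (Real.pi / 2 * Φ b) : ℝ) : ℂ) := by
      intro a b
      have : Complex.exp ((Real.pi * (a - b) : ℝ) * Complex.I) =
          conj (Complex.exp ((-Real.pi * a : ℝ) * Complex.I)) *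
            Complex.exp ((-Real.pi * b : ℝ) * Complex.I) := by
        rw [← Complex.exp_conj, ← Complex.exp_add]
        simp only [map_mul, Complex.conj_ofReal, Complex.conj_I]
        congr 1
        push_cast
        ring
      rw [this]
      simp only [meyerFourier, map_mul, Complex.conj_ofReal]
      push_cast
      ring
    rw [e, e, h.sin_mul_sin_shift x, ← add_mul]
    have e1 : Complex.exp ((Real.pi * (x - (x - 1)) : ℝ) * Complex.I) = -1 := by
      rw [sub_sub_cancel, mul_one, Complex.exp_pi_mul_I]
    have e2 : Complex.exp ((Real.pi * (2 * x - (2 * x - 2)) : ℝ) * Complex.I) = 1 := by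
      rw [sub_sub_cancel]
      push_cast
      rw [mul_comm (Real.pi : ℂ), Complex.exp_two_pi_mul_I]
    rw [e1, e2]
    ring
  integral_norm_sq := by
    simp only [norm_sq_meyerFourier]
    exact h.integral_sin_sq

end IsMeyerAngle

/-! ### Orthonormal bases from Parseval's identity -/

section Hilbert

open scoped InnerProductSpace

variable {E ι : Type*} [NormedAddCommGroup E] [InnerProductSpace ℂ E] {e : ι → E}

/-- In Parseval's identity for a unit vector of the family, the diagonal term alone exhausts the
sum, so all other terms vanish. -/
lemma orthonormal_of_hasSum_norm_sq (h1 : ∀ i, ‖e i‖ = 1)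
    (h : ∀ i, HasSum (fun j => ‖⟪e j, e i⟫_ℂ‖ ^ 2) (‖e i‖ ^ 2)) : Orthonormal ℂ e := by
  classical
  refine ⟨h1, fun i j hij => ?_⟩
  have hle := sum_le_hasSum {i, j} (fun _ _ => by positivity) (h j)
  rw [Finset.sum_pair hij, inner_self_eq_norm_sq_to_K, h1] at hle
  have h0 : ‖⟪e i, e j⟫_ℂ‖ ^ 2 ≤ 0 := by simpa using hle
  have h2 : ‖⟪e i, e j⟫_ℂ‖ = 0 := pow_eq_zero_iff two_ne_zero |>.1 (h0.antisymm (by positivity))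
  exact norm_eq_zero.1 h2

/-- The projection of f onto the closed span has the same coefficients as f, so Bessel's inequality
forces it to have the full norm of f. -/
lemma mem_topologicalClosure_of_hasSum_norm_sq [CompleteSpace E] (he : Orthonormal ℂ e) {f : E}
    (h : HasSum (fun i => ‖⟪e i, f⟫_ℂ‖ ^ 2) (‖f‖ ^ 2)) :
    f ∈ (Submodule.span ℂ (Set.range e)).topologicalClosure := by
  set K := (Submodule.span ℂ (Set.range e)).topologicalClosure with hK
  have : CompleteSpace K := (Submodule.isClosed_topologicalClosure _).completeSpace_coe
  have hmem : ∀ i, e i ∈ K := fun i =>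
    Submodule.le_topologicalClosure _ (Submodule.subset_span ⟨i, rfl⟩)
  have hin : ∀ i, ⟪e i, f⟫_ℂ = ⟪e i, K.starProjection f⟫_ℂ := fun i => by
    rw [← sub_eq_zero, ← inner_sub_right]
    exact K.inner_right_of_mem_orthogonal (hmem i) (K.sub_starProjection_mem_orthogonal f)
  have h1 : ‖f‖ ^ 2 ≤ ‖K.starProjection f‖ ^ 2 := by
    rw [← h.tsum_eq]
    simp only [hin]
    exact he.tsum_inner_products_le _
  rw [K.mem_iff_norm_starProjection]
  exact (K.norm_starProjection_apply_le f).antisymm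
    ((pow_le_pow_iff_left₀ (norm_nonneg _) (norm_nonneg _) two_ne_zero).1 h1)

/-- A family of unit vectors that satisfies Parseval's identity on itself and on a total set is
an orthonormal basis. -/
lemma exists_hilbertBasis_of_parseval [CompleteSpace E] (h1 : ∀ i, ‖e i‖ = 1)
    (h : ∀ i, HasSum (fun j => ‖⟪e j, e i⟫_ℂ‖ ^ 2) (‖e i‖ ^ 2)) {D : Set E}
    (hD : ∀ f ∈ D, HasSum (fun i => ‖⟪e i, f⟫_ℂ‖ ^ 2) (‖f‖ ^ 2))
    (hD' : ∀ u : E, (∀ f ∈ D, ⟪f, u⟫_ℂ = 0) → u = 0) : ∃ b : HilbertBasis ι ℂ E, ⇑b = e := by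
  have he := orthonormal_of_hasSum_norm_sq h1 h
  refine ⟨HilbertBasis.mkOfOrthogonalEqBot he ?_, HilbertBasis.coe_mkOfOrthogonalEqBot _ _⟩
  rw [← Submodule.orthogonal_closure, Submodule.eq_bot_iff]
  exact fun u hu => hD' u fun f hf => Submodule.inner_right_of_mem_orthogonal
    (mem_topologicalClosure_of_hasSum_norm_sq he (hD f hf)) hu

end Hilbert

/-! ### Meyer bands give orthogonal wavelets -/

section Wavelet

open scoped InnerProductSpace

lemma SchwartzMap.inner_toLp_two (f g : 𝓢(ℝ, ℂ)) :
    ⟪f.toLp 2, g.toLp 2⟫_ℂ = ∫ x, conj (f x) * g x := by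
  refine (SchwartzMap.inner_toL2_toL2_eq f g volume).trans (integral_congr_ae (ae_of_all _ fun x => ?_))
  simp only [RCLike.inner_apply]
  ring

lemma SchwartzMap.norm_sq_toLp_two (f : 𝓢(ℝ, ℂ)) : ‖f.toLp 2‖ ^ 2 = ∫ x, ‖f x‖ ^ 2 := by
  have h : ((‖f.toLp 2‖ ^ 2 : ℝ) : ℂ) = ((∫ x, ‖f x‖ ^ 2 : ℝ) : ℂ) := by
    rw [← integral_complex_ofReal]
    have := inner_self_eq_norm_sq_to_K (𝕜 := ℂ) (f.toLp 2)
    rw [SchwartzMap.inner_toLp_two] at this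
    rw [Complex.ofReal_pow]
    refine this.symm.trans (integral_congr_ae (ae_of_all _ fun x => ?_))
    simp only
    rw [Complex.conj_mul']
    push_cast
    rfl
  exact_mod_cast h

namespace IsAnnular

variable {F : ℝ → ℂ} {r R : ℝ} (hF : IsAnnular F r R)

/-- An annular function as a Schwartz function. -/
noncomputable def toSchwartz : 𝓢(ℝ, ℂ) := hF.hasCompactSupport.toSchwartzMap hF.contDiff

lemma toSchwartz_apply (x : ℝ) : hF.toSchwartz x = F x := rfl

end IsAnnular

/-- A square integrable function orthogonal to all annular functions vanishes. -/
lemma eq_zero_of_forall_annular_inner_eq_zero (u : Lp ℂ 2 (volume : Measure ℝ))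
    (hu : ∀ (F : ℝ → ℂ) (r R : ℝ) (hF : IsAnnular F r R), ⟪hF.toSchwartz.toLp 2, u⟫_ℂ = 0) :
    u = 0 := by
  -- Test functions supported away from the origin are annular and determine u off 0, which is a
  -- null set.
  have h := isOpen_compl_singleton (x := (0 : ℝ)).ae_eq_zero_of_integral_contDiff_smul_eq_zero
    (f := u) (μ := volume)
    (((Lp.memLp u).locallyIntegrable one_le_two).locallyIntegrableOn _) (by
      intro g hg hgc hgs
      obtain ⟨r, hr, hr'⟩ : ∃ r > 0, ∀ x, |x| < r → g x = 0 := by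
        have h0 : (tsupport g)ᶜ ∈ nhds (0 : ℝ) :=
          (isClosed_tsupport g).isOpen_compl.mem_nhds fun h => hgs h rfl
        obtain ⟨r, hr, hb⟩ := Metric.mem_nhds_iff.1 h0
        exact ⟨r, hr, fun x hx => image_eq_zero_of_notMem_tsupport (hb (by simpa using hx))⟩
      obtain ⟨R, hR⟩ := hgc.isBounded.subset_closedBall 0
      have hF : IsAnnular (fun x => (g x : ℂ)) r R := by
        refine ⟨Complex.ofRealCLM.contDiff.comp hg, hr, fun x hx => ?_⟩
        rw [Complex.ofReal_eq_zero]
        by_contra hne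
        have hmem := hR (subset_tsupport _ hne)
        refine hx ⟨not_lt.1 fun h => hne (hr' x h), by simpa using hmem⟩
      have h1 := hu _ r R hF
      rw [L2.inner_def] at h1
      rw [← h1]
      refine integral_congr_ae ?_
      filter_upwards [hF.toSchwartz.coeFn_toLp 2] with x hx
      rw [hx, hF.toSchwartz_apply, RCLike.inner_apply, Complex.real_smul, Complex.conj_ofReal,
        mul_comm])
  rw [Lp.eq_zero_iff_ae_eq_zero]
  have h0 : ∀ᵐ x : ℝ, x ≠ 0 := by simp [ae_iff]
  filter_upwards [h, h0] with x hx hx0 using hx hx0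

namespace IsMeyerBand

variable {β : ℝ → ℂ} (hβ : IsMeyerBand β)
include hβ

lemma isAnnular_waveletFourier (j k : ℤ) :
    IsAnnular (waveletFourier β j k) ((2 : ℝ) ^ j * (1 / 3)) ((2 : ℝ) ^ j * (4 / 3)) := by
  have hp : (0 : ℝ) < 2 ^ j := by positivity
  refine ⟨?_, by positivity, fun x hx => ?_⟩
  · have h1 : ContDiff ℝ ∞ fun x : ℝ => (2 : ℝ) ^ (-j) * x := contDiff_const.mul contDiff_id
    have h2 : ContDiff ℝ ∞ fun x : ℝ => ((-2 * Real.pi * k * ((2 : ℝ) ^ (-j) * x) : ℝ) : ℂ) :=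
      Complex.ofRealCLM.contDiff.comp (contDiff_const.mul h1)
    exact contDiff_const.mul ((h2.mul contDiff_const).cexp.mul (hβ.contDiff.comp h1))
  · rw [waveletFourier, hβ.eq_zero, mul_zero, mul_zero]
    intro h
    rw [abs_mul, abs_of_pos (by positivity), zpow_neg, ← div_eq_inv_mul] at h
    refine hx ⟨?_, ?_⟩
    · rw [← le_div_iff₀' hp]; exact h.1.le
    · rw [← div_le_iff₀' hp]; exact h.2.le

/-- The Schwartz function `waveletFourier β j k`. -/
noncomputable def waveletSchwartz (p : ℤ × ℤ) : 𝓢(ℝ, ℂ) :=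
  (hβ.isAnnular_waveletFourier p.1 p.2).toSchwartz

lemma integral_norm_sq_waveletFourier (j k : ℤ) : ∫ x, ‖waveletFourier β j k x‖ ^ 2 = 1 := by
  have h := Measure.integral_comp_mul_left (fun x => ‖β x‖ ^ 2) ((2 : ℝ) ^ (-j))
  rw [hβ.integral_norm_sq, abs_of_pos (by positivity), smul_eq_mul, mul_one, ← zpow_neg,
    neg_neg] at h
  have h1 : ∀ x, ‖waveletFourier β j k x‖ ^ 2 = (2 : ℝ) ^ (-j) * ‖β ((2 : ℝ) ^ (-j) * x)‖ ^ 2 := by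
    intro x
    rw [waveletFourier, norm_mul, norm_mul, Complex.norm_exp_ofReal_mul_I, one_mul, mul_pow,
      Complex.norm_real, Real.norm_eq_abs, sq_abs, ← Real.rpow_natCast (2 ^ (-(j : ℝ) / 2)),
      ← Real.rpow_mul two_pos.le,
      show -(j : ℝ) / 2 * (2 : ℕ) = ((-j : ℤ) : ℝ) by push_cast; ring, Real.rpow_intCast]
  simp only [h1]
  rw [integral_const_mul, h, ← zpow_add₀ two_ne_zero, neg_add_cancel, zpow_zero]

lemma parseval {F : ℝ → ℂ} {r R : ℝ} (hF : IsAnnular F r R) :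
    HasSum (fun p => ‖⟪(hβ.waveletSchwartz p).toLp 2, hF.toSchwartz.toLp 2⟫_ℂ‖ ^ 2)
      (‖hF.toSchwartz.toLp 2‖ ^ 2) := by
  simp only [SchwartzMap.inner_toLp_two, SchwartzMap.norm_sq_toLp_two]
  exact hβ.hasSum_norm_sq_coefficient hF

lemma norm_toLp_waveletSchwartz (p : ℤ × ℤ) : ‖(hβ.waveletSchwartz p).toLp 2‖ = 1 := by
  have h := SchwartzMap.norm_sq_toLp_two (hβ.waveletSchwartz p)
  have h' : ∫ x, ‖hβ.waveletSchwartz p x‖ ^ 2 = 1 := hβ.integral_norm_sq_waveletFourier p.1 p.2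
  rw [h'] at h
  exact (pow_eq_one_iff_of_nonneg (norm_nonneg _) two_ne_zero).1 h

lemma parseval_waveletSchwartz (p : ℤ × ℤ) :
    HasSum (fun q => ‖⟪(hβ.waveletSchwartz q).toLp 2, (hβ.waveletSchwartz p).toLp 2⟫_ℂ‖ ^ 2)
      (‖(hβ.waveletSchwartz p).toLp 2‖ ^ 2) :=
  hβ.parseval (hβ.isAnnular_waveletFourier p.1 p.2)

/-- The orthonormal basis formed by the Fourier transforms of the wavelets. -/
theorem exists_hilbertBasis :
    ∃ b : HilbertBasis (ℤ × ℤ) ℂ (Lp ℂ 2 (volume : Measure ℝ)),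
      ⇑b = fun p => (hβ.waveletSchwartz p).toLp 2 := by
  refine exists_hilbertBasis_of_parseval hβ.norm_toLp_waveletSchwartz hβ.parseval_waveletSchwartz
    (D := {f | ∃ (F : ℝ → ℂ) (r R : ℝ) (hF : IsAnnular F r R), f = hF.toSchwartz.toLp 2})
    ?_ fun u hu => ?_
  · rintro _ ⟨F, r, R, hF, rfl⟩
    exact hβ.parseval hF
  · exact eq_zero_of_forall_annular_inner_eq_zero u fun F r R hF => hu _ ⟨F, r, R, hF, rfl⟩

omit hβ in
lemma fourierInv_waveletFourier (j k : ℤ) (x : ℝ) :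
    𝓕⁻ (waveletFourier β j k) x = dyadicWavelet (𝓕⁻ β) j k x := by
  have h := Measure.integral_comp_mul_left (fun t =>
    Complex.exp ((2 * Real.pi * ((2 : ℝ) ^ j * x - k) * t : ℝ) * Complex.I) * β t)
    ((2 : ℝ) ^ (-j))
  rw [abs_of_pos (by positivity), ← zpow_neg, neg_neg, Complex.real_smul] at h
  have h1 : ∀ t, Complex.exp ((2 * Real.pi * x * t : ℝ) * Complex.I) * waveletFourier β j k t =
      (((2 : ℝ) ^ (-(j : ℝ) / 2) : ℝ) : ℂ) *
        (Complex.exp ((2 * Real.pi * ((2 : ℝ) ^ j * x - k) * ((2 : ℝ) ^ (-j) * t) : ℝ) *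
          Complex.I) * β ((2 : ℝ) ^ (-j) * t)) := by
    intro t
    have h2 : x * t = ((2 : ℝ) ^ j * x) * ((2 : ℝ) ^ (-j) * t) := by
      rw [mul_mul_mul_comm, ← zpow_add₀ two_ne_zero, add_neg_cancel, zpow_zero, one_mul]
    rw [waveletFourier, mul_left_comm, ← mul_assoc (Complex.exp _) (Complex.exp _),
      ← Complex.exp_add]
    congr 3
    rw [← add_mul, ← Complex.ofReal_add]
    congr 2
    rw [mul_assoc (2 * Real.pi) x t, h2]
    ring
  rw [fourierInv_apply_eq_integral, integral_congr_ae (ae_of_all _ h1), integral_const_mul, h,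
    dyadicWavelet, fourierInv_apply_eq_integral, ← mul_assoc, ← Complex.ofReal_mul,
    ← Real.rpow_intCast, ← Real.rpow_add two_pos]
  congr 3
  ring

theorem isOrthogonalWavelet : IsOrthogonalWavelet (𝓕⁻ β) := by
  obtain ⟨b, hb⟩ := hβ.exists_hilbertBasis
  let U := Lp.fourierTransformₗᵢ ℝ ℂ
  -- Composing the coordinates of the frequency-side basis with the Plancherel isometry gives a
  -- basis whose vectors are the inverse transforms.
  refine ⟨HilbertBasis.ofRepr (U.trans b.repr), fun j k => ?_⟩
  have h1 : HilbertBasis.ofRepr (U.trans b.repr) (j, k) = 𝓕⁻ (b (j, k)) := rfl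
  rw [h1, hb, SchwartzMap.toLp_fourierInv_eq]
  refine ((𝓕⁻ (hβ.waveletSchwartz (j, k))).coeFn_toLp 2).trans (ae_of_all _ fun x => ?_)
  rw [SchwartzMap.fourierInv_coe]
  exact fourierInv_waveletFourier j k x

/-- `β` as a Schwartz function. -/
noncomputable def toSchwartz : 𝓢(ℝ, ℂ) := hβ.hasCompactSupport.toSchwartzMap hβ.contDiff

lemma fourier_fourierInv : 𝓕 (𝓕⁻ β) = β := by
  have h : 𝓕 (𝓕⁻ hβ.toSchwartz) = hβ.toSchwartz := FourierTransform.fourier_fourierInv_eq _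
  have h2 := congrArg (fun F : 𝓢(ℝ, ℂ) => (F : ℝ → ℂ)) h
  simp only [SchwartzMap.fourier_coe, SchwartzMap.fourierInv_coe] at h2
  exact h2

theorem isBandLimited : IsBandLimited (𝓕⁻ β) := by
  have h : ((𝓕⁻ hβ.toSchwartz : 𝓢(ℝ, ℂ)) : ℝ → ℂ) = 𝓕⁻ β := SchwartzMap.fourierInv_coe _
  refine ⟨?_, ?_, ?_⟩
  · rw [← h]; exact (𝓕⁻ hβ.toSchwartz).continuous
  · rw [← h]; exact (𝓕⁻ hβ.toSchwartz).integrable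
  · rw [hβ.fourier_fourierInv]; exact hβ.hasCompactSupport

theorem isMeyerType : IsMeyerType (𝓕⁻ β) := by
  refine ⟨?_, ?_⟩
  · rw [hβ.fourier_fourierInv]; exact hβ.contDiff
  · rw [hβ.fourier_fourierInv]
    refine closure_minimal (fun x hx => ?_) ?_
    · by_contra h
      exact hx (hβ.eq_zero x fun h' => h ⟨h'.1.le, h'.2.le⟩)
    · exact (isClosed_le continuous_const continuous_abs).inter
        (isClosed_le continuous_abs continuous_const)

end IsMeyerBand

end Wavelet

/-! ### Wavelets with prescribed decay and the main theorem -/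

theorem exists_wavelet_of_decayRate {m : ℝ → ℝ} (hm : IsDecayRate m)
    (hsum : Summable fun n : ℕ => m n / n) :
    ∃ c : ℝ, 0 < c ∧ ∃ ψ : ℝ → ℂ, IsBandLimited ψ ∧ IsMeyerType ψ ∧ IsOrthogonalWavelet ψ ∧
      ∀ x : ℝ, ‖ψ x‖ ≤ c * Real.exp (-(|x| * m |x|)) := by
  obtain ⟨Φ, hΦ, C, hC⟩ := exists_meyerAngle hm hsum
  obtain ⟨A, hA⟩ := exists_fourierInv_meyerFourier_decay hm hΦ hC
  have hβ := hΦ.isMeyerBand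
  refine ⟨max A 1, lt_max_of_lt_right one_pos, 𝓕⁻ (meyerFourier Φ), hβ.isBandLimited,
    hβ.isMeyerType, hβ.isOrthogonalWavelet, fun x => (hA x).trans ?_⟩
  gcongr
  exact le_max_left _ _

theorem exists_wavelet_iterLog (ℓ : ℕ) {ε : ℝ} (hε : 0 < ε) (hε1 : ε ≤ 1) :
    ∃ c : ℝ, 0 < c ∧ ∃ ψ : ℝ → ℂ, IsBandLimited ψ ∧ IsMeyerType ψ ∧ IsOrthogonalWavelet ψ ∧
      ∀ x : ℝ, ‖ψ x‖ ≤ c * Real.exp (-(1 * ε * |x| / iterLogProduct ℓ ε |x|)) := by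
  have h := exists_wavelet_of_decayRate (isDecayRate_iterLogRate ℓ hε hε1)
    (summable_iterLogRate_div ℓ hε hε1)
  have e : ∀ x : ℝ, |x| * iterLogRate ℓ ε |x| = 1 * ε * |x| / iterLogProduct ℓ ε |x| := fun x => by
    unfold iterLogRate; ring
  simpa only [e] using h

theorem theorem2p3 :
    ∃ c' : ℝ, 0 < c' ∧
      (∀ ε : ℝ, 0 < ε → ε ≤ 1 →
        ∃ c : ℝ, 0 < c ∧ ∃ ψ : ℝ → ℂ,
          IsBandLimited ψ ∧ IsMeyerType ψ ∧ IsOrthogonalWavelet ψ ∧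
          ∀ x : ℝ, ‖ψ x‖ ≤
            c * Real.exp (-(c' * ε * |x| / Real.log (Real.exp 1 + |x|) ^ (1 + ε)))) ∧
      (∀ ℓ : ℕ, 1 ≤ ℓ → ∀ ε : ℝ, 0 < ε → ε ≤ 1 →
        ∃ c : ℝ, 0 < c ∧ ∃ ψ : ℝ → ℂ,
          IsBandLimited ψ ∧ IsMeyerType ψ ∧ IsOrthogonalWavelet ψ ∧
          ∀ x : ℝ, ‖ψ x‖ ≤
            c * Real.exp (-(c' * ε * |x| / iterLogProduct ℓ ε |x|))) := by
  -- The factor ε is already part of the rate, so c' = 1. The first claim is the case ℓ = 0, where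
  -- the product of logarithms is empty.
  refine ⟨1, one_pos, fun ε hε hε1 => ?_, fun ℓ _ ε hε hε1 => exists_wavelet_iterLog ℓ hε hε1⟩
  have h := exists_wavelet_iterLog 0 hε hε1
  have e : ∀ t, iterLogProduct 0 ε t = Real.log (Real.exp 1 + t) ^ (1 + ε) := fun t => by
    simp [iterLogProduct, iterLog]
  simpa only [e] using h
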